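/- Let $M$ be a complex manifold of complex dimension $n$ with complex structure $J$, and let $g$ be a smooth Hermitian metric on $M$. In holomorphic coordinates write $g_{j\bar k}$ for its components, normalized so that $g(u,v)=\operatorname{Re}\sum g_{j\bar k}u^j\overline{v^k}$; thus the Kähler form $\omega(u,v)=-g(u,Jv)$ is $\omega=\frac{\sqrt{-1}}2 g_{j\bar k}\,dz^j\wedge d\bar z^k$. Let $g^{k\bar l}$ be the inverse, $g^{k\bar l}g_{j\bar l}=\delta^k_j$. The Chern connection has $\Gamma_{ij}^k=g^{k\bar l}\partial_i g_{j\bar l}$, torsion $T_{ij\bar k}=g_{l\bar k}(\Gamma^l_{ij}-\Gamma^l_{ji})$, $T_{\bar i\bar j k}=\overline{T_{ij\bar k}}$, and curvature $\Omega_{l\bar m j\bar k}=-g_{p\bar k}\,\partial_{\bar m}\Gamma^p_{lj}$. Put $S_{j\bar k}=g^{l\bar m}\Omega_{l\bar m j\bar k}$ and $$Q^1_{i\bar j}=g^{k\bar l}g^{m\bar n}T_{ik\bar n}T_{\bar j\bar l m},\qquad Q^2_{i\bar j}=g^{k\bar l}g^{m\bar n}T_{\bar l\bar n i}T_{km\bar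 j},\qquad Q^3_{i\bar j}=g^{k\bar l}g^{m\bar n}T_{ik\bar l}T_{\bar j\bar n m},$$ $$Q^4_{i\bar j}=\tfrac12 g^{k\bar l}g^{m\bar n}\left(T_{mk\bar l}T_{\bar n\bar j i}+T_{\bar n\bar l k}T_{mi\bar j}\right),\qquad Q=\tfrac12Q^1-\tfrac14Q^2-\tfrac12Q^3+Q^4.$$ Let $\partial_g^*,\bar\partial_g^*$ be the (formal) $L^2$ adjoints of $\partial,\bar\partial$ for the Hermitian inner product on forms induced by $\langle dz^i,dz^j\rangle=g^{i\bar j}$ and the volume form $\omega^n/n!$. For a $(1,0)$-form $\alpha=\alpha_p\,dz^p$ and a $(1,2)$-form $\beta=\frac12\beta_{j\bar q\bar k}\,dz^j\wedge d\bar z^q\wedge d\bar z^k$ put $(\alpha\lrcorner\beta)_{j\bar k}=g^{p\bar q}\alpha_p\beta_{j\bar q\bar k}$. Let $$\Psi(\omega)=\partial_g^*\partial\omega-\partial\partial_g^*\omega-\frac{\sqrt{-1}}2\partial\bar\partial\log\det g-2\sqrt{-1}\left(\bar\partial_g^*\omega\lrcorner\bar\partial\omega\right).$$ (1) The adjoint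 forms $\partial_g^*\omega$, $\bar\partial_g^*\omega$, $\partial_g^*\partial\omega$ exist and are unique. Let $\Xi(g)(u,v)=-S(u,Jv)=S(Ju,v)$ be the $(1,1)$-form associated with $S$ in the way $\omega$ is associated with $g$. In all holomorphic coordinates $$\Xi(g)_{j\bar k}=\Psi(\omega)_{j\bar k}-\frac{\sqrt{-1}}2\left(\tfrac12Q^2_{j\bar k}-2Q^4_{j\bar k}\right).$$ (2) Let $g(t)$ be a family of smooth Hermitian metrics on $M$ and $D\subseteq\mathbb R$ a set of times (for example an interval). Then $g(t)$ satisfies the Hermitian curvature flow equation $\frac{\partial}{\partial t}g=-S+Q$ for $t\in D$ if and only if its Kähler forms satisfy, for $t\in D$, $$\frac{\partial}{\partial t}\omega=-\Psi(\omega)+\frac{\sqrt{-1}}2\left(\tfrac12Q^1+\tfrac14Q^2-\tfrac12Q^3-Q^4\right).$$ (Here a tensor $A_{j\bar k}$ in a bracket after $\frac{\sqrt{-1}}2$ stands for the form $\frac{\sqrt{-1}}2A_{j\bar k}\,dz^j\wedge d\bar z^k$; time derivatives are taken within $D$.) -/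

import Mathlib

open scoped Manifold ContDiff ComplexConjugate
open MeasureTheory

noncomputable section

namespace HermitianFlow

/-- Complex coordinate space `ℂⁿ`. -/
abbrev CSpace (n : ℕ) : Type := Fin n → ℂ

/-! ### Calculus in complex coordinates -/

/-- `∂f/∂zⁱ = ½ (∂f/∂xⁱ - √-1 ∂f/∂yⁱ)`. -/
def dz {n : ℕ} (i : Fin n) (f : CSpace n → ℂ) (z : CSpace n) : ℂ :=
  (1 / 2 : ℂ) * (fderiv ℝ f z (Pi.single i 1) - Complex.I * fderiv ℝ f z (Pi.single i Complex.I))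

/-- `∂f/∂z̄ⁱ = ½ (∂f/∂xⁱ + √-1 ∂f/∂yⁱ)`. -/
def dzbar {n : ℕ} (i : Fin n) (f : CSpace n → ℂ) (z : CSpace n) : ℂ :=
  (1 / 2 : ℂ) * (fderiv ℝ f z (Pi.single i 1) + Complex.I * fderiv ℝ f z (Pi.single i Complex.I))

/-- Components of a `(p,q)`-form in complex coordinates:
`α = 1/(p! q!) ∑ α_{I J̄} dz^{I₁} ∧ ⋯ ∧ dz^{I_p} ∧ dz̄^{J₁} ∧ ⋯ ∧ dz̄^{J_q}`;
the entry `α z I J` is the value `α(∂_{I₁}, …, ∂_{I_p}, ∂_{J̄₁}, …, ∂_{J̄_q})` at the point `z`. -/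
abbrev CForm (n p q : ℕ) : Type :=
  CSpace n → (Fin p → Fin n) → (Fin q → Fin n) → ℂ

/-- `α` is a smooth `(p,q)`-form on `U`: its components are smooth on `U` and alternating in the
holomorphic indices and in the antiholomorphic ones. -/
structure IsSmoothForm {n p q : ℕ} (U : Set (CSpace n)) (α : CForm n p q) : Prop where
  smooth : ∀ I J, ContDiffOn ℝ ∞ (fun z => α z I J) U
  alternating_left : ∀ z ∈ U, ∀ I J, ∀ σ : Equiv.Perm (Fin p),
    α z (fun s => I (σ s)) J = ((Equiv.Perm.sign σ : ℤ) : ℂ) * α z I J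
  alternating_right : ∀ z ∈ U, ∀ I J, ∀ σ : Equiv.Perm (Fin q),
    α z I (fun s => J (σ s)) = ((Equiv.Perm.sign σ : ℤ) : ℂ) * α z I J

/-- A test form on `U`: a smooth form on `ℂⁿ` with compact support contained in `U`. -/
structure IsTestForm {n p q : ℕ} (U : Set (CSpace n)) (γ : CForm n p q) : Prop where
  form : IsSmoothForm Set.univ γ
  compact : ∀ I J, HasCompactSupport (fun z => γ z I J)
  support : ∀ I J, tsupport (fun z => γ z I J) ⊆ U

/-- The operator `∂ : Λ^{p,q} → Λ^{p+1,q}`. -/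
def del {n p q : ℕ} (α : CForm n p q) : CForm n (p + 1) q := fun z I J =>
  ∑ k : Fin (p + 1), (-1 : ℂ) ^ (k : ℕ) * dz (I k) (fun y => α y (fun s => I (k.succAbove s)) J) z

/-- The operator `∂̄ : Λ^{p,q} → Λ^{p,q+1}`; the sign `(-1)^p` moves `dz̄` past
the `p` factors `dz`. -/
def delbar {n p q : ℕ} (α : CForm n p q) : CForm n p (q + 1) := fun z I J =>
  (-1 : ℂ) ^ p * ∑ k : Fin (q + 1),
    (-1 : ℂ) ^ (k : ℕ) * dzbar (J k) (fun y => α y I (fun s => J (k.succAbove s))) z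

/-! ### Hermitian metrics in coordinates

A Hermitian metric is given in coordinates by the matrix function `G z j k = g_{j k̄}(z)`. -/

/-- `g^{k l̄}`, with `∑ₗ g_{j l̄} g^{k l̄} = δ_j^k`. -/
def gInv {n : ℕ} (G : CSpace n → Matrix (Fin n) (Fin n) ℂ) (z : CSpace n) (k l : Fin n) : ℂ :=
  (G z)⁻¹ l k

/-- Christoffel symbols of the Chern connection, `Γ_{ij}^k = g^{k l̄} ∂_i g_{j l̄}`. -/
def chernGamma {n : ℕ} (G : CSpace n → Matrix (Fin n) (Fin n) ℂ) (i j k : Fin n)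
    (z : CSpace n) : ℂ :=
  ∑ l, gInv G z k l * dz i (fun y => G y j l) z

/-- Torsion of the Chern connection, `T_{ij}^k = Γ_{ij}^k - Γ_{ji}^k`. -/
def torsionUp {n : ℕ} (G : CSpace n → Matrix (Fin n) (Fin n) ℂ) (i j k : Fin n)
    (z : CSpace n) : ℂ :=
  chernGamma G i j k z - chernGamma G j i k z

/-- `T_{i j k̄} = T_{ij}^l g_{l k̄}`. -/
def torsion {n : ℕ} (G : CSpace n → Matrix (Fin n) (Fin n) ℂ) (z : CSpace n)
    (i j k : Fin n) : ℂ :=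
  ∑ l, torsionUp G i j l z * G z l k

/-- `T_{ī j̄ k}`, the conjugate of `T_{i j k̄}`. -/
def torsionBar {n : ℕ} (G : CSpace n → Matrix (Fin n) (Fin n) ℂ) (z : CSpace n)
    (i j k : Fin n) : ℂ :=
  conj (torsion G z i j k)

/-- Curvature of the Chern connection, `Ω_{l m̄ j k̄} = - g_{p k̄} ∂_{m̄} Γ_{l j}^p`. -/
def chernCurvature {n : ℕ} (G : CSpace n → Matrix (Fin n) (Fin n) ℂ) (z : CSpace n)
    (l m j k : Fin n) : ℂ :=
  -∑ p, G z p k * dzbar m (chernGamma G l j p) z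

/-- `S_{j k̄} = g^{l m̄} Ω_{l m̄ j k̄}`. -/
def chernS {n : ℕ} (G : CSpace n → Matrix (Fin n) (Fin n) ℂ) (z : CSpace n) :
    Matrix (Fin n) (Fin n) ℂ := fun j k =>
  ∑ l, ∑ m, gInv G z l m * chernCurvature G z l m j k

/-- `Q¹_{i j̄} = g^{k l̄} g^{m n̄} T_{i k n̄} T_{j̄ l̄ m}`. -/
def Q1 {n : ℕ} (G : CSpace n → Matrix (Fin n) (Fin n) ℂ) (z : CSpace n) :
    Matrix (Fin n) (Fin n) ℂ := fun i j =>
  ∑ k, ∑ l, ∑ m, ∑ r, gInv G z k l * gInv G z m r * (torsion G z i k r * torsionBar G z j l m)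

/-- `Q²_{i j̄} = g^{k l̄} g^{m n̄} T_{l̄ n̄ i} T_{k m j̄}`. -/
def Q2 {n : ℕ} (G : CSpace n → Matrix (Fin n) (Fin n) ℂ) (z : CSpace n) :
    Matrix (Fin n) (Fin n) ℂ := fun i j =>
  ∑ k, ∑ l, ∑ m, ∑ r, gInv G z k l * gInv G z m r * (torsionBar G z l r i * torsion G z k m j)

/-- `Q³_{i j̄} = g^{k l̄} g^{m n̄} T_{i k l̄} T_{j̄ n̄ m}`. -/
def Q3 {n : ℕ} (G : CSpace n → Matrix (Fin n) (Fin n) ℂ) (z : CSpace n) :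
    Matrix (Fin n) (Fin n) ℂ := fun i j =>
  ∑ k, ∑ l, ∑ m, ∑ r, gInv G z k l * gInv G z m r * (torsion G z i k l * torsionBar G z j r m)

/-- `Q⁴_{i j̄} = ½ g^{k l̄} g^{m n̄} (T_{m k l̄} T_{n̄ j̄ i} + T_{n̄ l̄ k} T_{m i j̄})`. -/
def Q4 {n : ℕ} (G : CSpace n → Matrix (Fin n) (Fin n) ℂ) (z : CSpace n) :
    Matrix (Fin n) (Fin n) ℂ := fun i j =>
  (1 / 2 : ℂ) * ∑ k, ∑ l, ∑ m, ∑ r, gInv G z k l * gInv G z m r *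
    (torsion G z m k l * torsionBar G z r j i + torsionBar G z r l k * torsion G z m i j)

/-- `Q = ½ Q¹ - ¼ Q² - ½ Q³ + Q⁴`. -/
def Qtot {n : ℕ} (G : CSpace n → Matrix (Fin n) (Fin n) ℂ) (z : CSpace n) :
    Matrix (Fin n) (Fin n) ℂ :=
  (1 / 2 : ℂ) • Q1 G z - (1 / 4 : ℂ) • Q2 G z - (1 / 2 : ℂ) • Q3 G z + Q4 G z

/-! ### Real (1,1) tensors and their associated two-forms -/

/-- The real bilinear form `A(u,v) = Re ∑ A_{j k̄} uʲ v̄ᵏ` with Hermitian components `A_{j k̄}`. -/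
def realTensor {n : ℕ} (A : Matrix (Fin n) (Fin n) ℂ) (u v : CSpace n) : ℝ :=
  (∑ j, ∑ k, A j k * u j * conj (v k)).re

/-- The value `B(∂_j, ∂_{k̄})` of the complex bilinear extension of a real bilinear form `B`,
where `∂_j = ½ (e_j - √-1 J e_j)` and `∂_{k̄} = ½ (e_k + √-1 J e_k)`. -/
def complexEntry {n : ℕ} (B : CSpace n → CSpace n → ℝ) (j k : Fin n) : ℂ :=
  (1 / 4 : ℂ) *
    ((B (Pi.single j 1) (Pi.single k 1) : ℂ)
      + Complex.I * (B (Pi.single j 1) (Pi.single k Complex.I) : ℂ)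
      - Complex.I * (B (Pi.single j Complex.I) (Pi.single k 1) : ℂ)
      + (B (Pi.single j Complex.I) (Pi.single k Complex.I) : ℂ))

/-- The `(1,1)`-form `(u,v) ↦ - A(u, J v)` associated with a real `(1,1)` tensor `A`. -/
def assocForm {n : ℕ} (A : CSpace n → Matrix (Fin n) (Fin n) ℂ) : CForm n 1 1 := fun z I J =>
  complexEntry (fun u v => -realTensor (A z) u (Complex.I • v)) (I 0) (J 0)

/-- The `(1,1)`-form `(√-1/2) ∑ A_{j k̄} dzʲ ∧ dz̄ᵏ`. -/
def halfIForm {n : ℕ} (A : CSpace n → Matrix (Fin n) (Fin n) ℂ) : CForm n 1 1 := fun z I J =>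
  (Complex.I / 2) * A z (I 0) (J 0)

/-- The Kähler form `ω(u,v) = - g(u, J v)`. -/
def kahlerForm {n : ℕ} (G : CSpace n → Matrix (Fin n) (Fin n) ℂ) : CForm n 1 1 := assocForm G

/-- The `(1,1)`-form obtained from `S` in the way in which `ω` is obtained from `g`,
`Ξ(u,v) = - S(u, J v) = S(J u, v)`. -/
def Xi {n : ℕ} (G : CSpace n → Matrix (Fin n) (Fin n) ℂ) : CForm n 1 1 := assocForm (chernS G)

/-! ### Hodge operators -/

/-- Pointwise Hermitian inner product of `(p,q)`-forms, normalized by `⟨dzⁱ, dzʲ⟩ = g^{i j̄}`. -/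
def formInner {n p q : ℕ} (G : CSpace n → Matrix (Fin n) (Fin n) ℂ) (α β : CForm n p q)
    (z : CSpace n) : ℂ :=
  (1 / ((p.factorial : ℂ) * (q.factorial : ℂ))) *
    ∑ I : Fin p → Fin n, ∑ A : Fin p → Fin n, ∑ J : Fin q → Fin n, ∑ B : Fin q → Fin n,
      (∏ s, gInv G z (I s) (A s)) * (∏ s, gInv G z (B s) (J s)) * (α z I J * conj (β z A B))

/-- `L²` inner product over `U` for the volume form `ωⁿ/n! = det(g_{j k̄}) dLebesgue`. -/
def l2Inner {n p q : ℕ} (U : Set (CSpace n)) (G : CSpace n → Matrix (Fin n) (Fin n) ℂ)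
    (α β : CForm n p q) : ℂ :=
  ∫ z in U, formInner G α β z * (G z).det

/-- `η = D* β` on `U` for the `L²` inner product: `η` is a smooth form on `U` and
`(η, γ) = (β, D γ)` for all test forms `γ` on `U`. The operators are local and test forms on a
coordinate domain extend by zero, so that this determines the adjoint on a manifold as well. -/
structure IsL2Adjoint {n p q p' q' : ℕ} (U : Set (CSpace n))
    (G : CSpace n → Matrix (Fin n) (Fin n) ℂ) (D : CForm n p q → CForm n p' q')
    (β : CForm n p' q') (η : CForm n p q) : Prop where
  smooth : IsSmoothForm U η
  adjoint : ∀ γ : CForm n p q, IsTestForm U γ → l2Inner U G η γ = l2Inner U G β (D γ)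

/-- `D* β` exists on `U` and is unique there. -/
def HasUniqueL2Adjoint {n p q p' q' : ℕ} (U : Set (CSpace n))
    (G : CSpace n → Matrix (Fin n) (Fin n) ℂ) (D : CForm n p q → CForm n p' q')
    (β : CForm n p' q') : Prop :=
  (∃ η, IsL2Adjoint U G D β η) ∧
    ∀ η η', IsL2Adjoint U G D β η → IsL2Adjoint U G D β η' → Set.EqOn η η' U

open Classical in
/-- The `L²` adjoint `D* β` on `U` (zero if there is none). -/
def l2Adjoint {n p q p' q' : ℕ} (U : Set (CSpace n))
    (G : CSpace n → Matrix (Fin n) (Fin n) ℂ) (D : CForm n p q → CForm n p' q')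
    (β : CForm n p' q') : CForm n p q :=
  if h : ∃ η, IsL2Adjoint U G D β η then h.choose else 0

/-- The adjoint `∂*_g : Λ^{p+1,q} → Λ^{p,q}`. -/
def delStar {n p q : ℕ} (U : Set (CSpace n)) (G : CSpace n → Matrix (Fin n) (Fin n) ℂ)
    (β : CForm n (p + 1) q) : CForm n p q :=
  l2Adjoint U G del β

/-- The adjoint `∂̄*_g : Λ^{p,q+1} → Λ^{p,q}`. -/
def delbarStar {n p q : ℕ} (U : Set (CSpace n)) (G : CSpace n → Matrix (Fin n) (Fin n) ℂ)
    (β : CForm n p (q + 1)) : CForm n p q :=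
  l2Adjoint U G delbar β

/-- Contraction of a `(1,2)`-form with a `(1,0)`-form by the metric, in the first antiholomorphic
index: `(α ⌟ β)_{j k̄} = g^{p q̄} α_p β_{j q̄ k̄}`. -/
def hook {n : ℕ} (G : CSpace n → Matrix (Fin n) (Fin n) ℂ) (α : CForm n 1 0)
    (β : CForm n 1 2) : CForm n 1 1 := fun z I J =>
  ∑ p, ∑ q, gInv G z p q * α z ![p] ![] * β z I ![q, J 0]

/-- The function `log det g`. -/
def logDet {n : ℕ} (G : CSpace n → Matrix (Fin n) (Fin n) ℂ) : CForm n 0 0 := fun z _ _ =>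
  (Real.log (G z).det.re : ℂ)

/-- `Ψ(ω) = ∂*∂ω - ∂∂*ω - (√-1/2) ∂∂̄ log det g - 2√-1 (∂̄*ω ⌟ ∂̄ω)`. -/
def Psi {n : ℕ} (U : Set (CSpace n)) (G : CSpace n → Matrix (Fin n) (Fin n) ℂ) : CForm n 1 1 :=
  delStar U G (del (kahlerForm G)) - del (delStar U G (kahlerForm G))
    - (Complex.I / 2) • del (delbar (logDet G))
    - (2 * Complex.I) • hook G (delbarStar U G (kahlerForm G)) (delbar (kahlerForm G))

/-! ### Hermitian metrics on complex manifolds -/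

/-- Differential at `z` of the inverse of a holomorphic chart. -/
def chartVec {n : ℕ} {M : Type*} [TopologicalSpace M] [ChartedSpace (CSpace n) M]
    (φ : OpenPartialHomeomorph M (CSpace n)) (z : CSpace n) (u : CSpace n) :
    TangentSpace 𝓘(ℂ, CSpace n) (φ.symm z) :=
  mfderiv 𝓘(ℂ, CSpace n) 𝓘(ℂ, CSpace n) φ.symm z u

/-- A smooth Hermitian metric: a Riemannian metric `g` with `g(Ju, Jv) = g(u, v)`, where `J` is
multiplication by `√-1` on the tangent spaces of the complex manifold `M`. -/
structure HermitianMetric (n : ℕ) (M : Type*) [TopologicalSpace M] [ChartedSpace (CSpace n) M] where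
  val : ∀ x : M, TangentSpace 𝓘(ℂ, CSpace n) x → TangentSpace 𝓘(ℂ, CSpace n) x → ℝ
  add_left : ∀ x u u' v, val x (u + u') v = val x u v + val x u' v
  smul_left : ∀ x (c : ℝ) u v, val x ((c : ℂ) • u) v = c * val x u v
  symm : ∀ x u v, val x u v = val x v u
  pos : ∀ x u, u ≠ 0 → 0 < val x u u
  J_invariant : ∀ x u v, val x (Complex.I • u) (Complex.I • v) = val x u v
  smooth : ∀ φ ∈ IsManifold.maximalAtlas 𝓘(ℂ, CSpace n) ω M, ∀ u v : CSpace n,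
    ContDiffOn ℝ ∞ (fun z => val (φ.symm z) (chartVec φ z u) (chartVec φ z v)) φ.target

/-- Components in a chart, `g_{j k̄} = g(∂/∂xʲ, ∂/∂xᵏ) + √-1 g(∂/∂xʲ, J ∂/∂xᵏ)`; equivalently
`g(u,v) = Re ∑ g_{j k̄} uʲ v̄ᵏ`. This is the normalization with `ω = (√-1/2) g_{j k̄} dzʲ ∧ dz̄ᵏ`. -/
def HermitianMetric.comp {n : ℕ} {M : Type*} [TopologicalSpace M] [ChartedSpace (CSpace n) M]
    (g : HermitianMetric n M) (φ : OpenPartialHomeomorph M (CSpace n)) (z : CSpace n) :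
    Matrix (Fin n) (Fin n) ℂ := fun j k =>
  (g.val (φ.symm z) (chartVec φ z (Pi.single j 1)) (chartVec φ z (Pi.single k 1)) : ℂ)
    + Complex.I *
      (g.val (φ.symm z) (chartVec φ z (Pi.single j 1)) (chartVec φ z (Pi.single k Complex.I)) : ℂ)

/-- The equation `∂g/∂t = - S + Q` of Hermitian curvature flow for times `t ∈ D`, written in all
holomorphic charts. -/
def IsHCF {n : ℕ} {M : Type*} [TopologicalSpace M] [ChartedSpace (CSpace n) M]
    (D : Set ℝ) (g : ℝ → HermitianMetric n M) : Prop :=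
  ∀ t ∈ D, ∀ φ ∈ IsManifold.maximalAtlas 𝓘(ℂ, CSpace n) ω M, ∀ z ∈ φ.target, ∀ j k : Fin n,
    HasDerivWithinAt (fun s => (g s).comp φ z j k)
      (-chernS ((g t).comp φ) z j k + Qtot ((g t).comp φ) z j k) D t

end HermitianFlow

end

/-! Integration by parts shows that the adjoint of `∂` acts on components with raised indices as a
divergence weighted by `det g`; conjugation gives the adjoint of `∂̄`. Testing against a bump
function times the raised form shows that adjoints are unique.

Applied to `ω`, the adjoints become traces of the torsion. Differentiating `∂ω` once more,
`∂*∂ω` produces `S` minus the mixed Ricci contraction `g^{l m̄} Ω_{j m̄ l k̄}`, plus torsion terms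
quadratic in `T`; the mixed contraction is cancelled by `∂∂*ω + (√-1/2) ∂∂̄ log det g`, since
`∂* ω` and `∂̄ log det g` together amount to the trace of `∂̄` of the metric over the other pair of
indices. The hook term turns the surviving torsion traces into `Q⁴`. Part (2) is then algebra,
because `A ↦ (√-1/2) A_{j k̄} dzʲ ∧ dz̄ᵏ` is linear and injective. -/

noncomputable section

namespace HermitianFlow

section Calculus

variable {n : ℕ} {E : Type*} [NormedAddCommGroup E] [NormedSpace ℝ E]

/-- A complex vector field `v + √-1 w` with constant coefficients, encoded by its action on
functions; `∂/∂zⁱ` and `∂/∂z̄ⁱ` are such fields. -/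
def IsConstantVectorField (D : (E → ℂ) → E → ℂ) : Prop :=
  ∃ v w : E, ∀ f z, D f z = fderiv ℝ f z v + Complex.I * fderiv ℝ f z w

theorem isConstantVectorField_dz (i : Fin n) : IsConstantVectorField (dz i) :=
  ⟨(1 / 2 : ℝ) • Pi.single i 1, -((1 / 2 : ℝ) • Pi.single i Complex.I), fun f z => by
    simp only [dz, map_neg, map_smul, Complex.real_smul]; push_cast; ring⟩

theorem isConstantVectorField_dzbar (i : Fin n) : IsConstantVectorField (dzbar i) :=
  ⟨(1 / 2 : ℝ) • Pi.single i 1, (1 / 2 : ℝ) • Pi.single i Complex.I, fun f z => by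
    simp only [dzbar, map_smul, Complex.real_smul]; push_cast; ring⟩

namespace IsConstantVectorField

variable {D D' : (E → ℂ) → E → ℂ} {f h : E → ℂ} {z : E} {U : Set E}

theorem congr_of_eventuallyEq (hD : IsConstantVectorField D) (hfh : f =ᶠ[nhds z] h) :
    D f z = D h z := by
  obtain ⟨v, w, hD⟩ := hD
  rw [hD, hD, hfh.fderiv_eq]

theorem congr_of_eqOn (hD : IsConstantVectorField D) (hU : IsOpen U) (hfh : Set.EqOn f h U)
    (hz : z ∈ U) : D f z = D h z :=
  hD.congr_of_eventuallyEq (hfh.eventuallyEq_of_mem (hU.mem_nhds hz))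

theorem const (hD : IsConstantVectorField D) (c : ℂ) : D (fun _ => c) z = 0 := by
  obtain ⟨v, w, hD⟩ := hD
  simp [hD]

theorem mul (hD : IsConstantVectorField D) (hf : DifferentiableAt ℝ f z)
    (hh : DifferentiableAt ℝ h z) : D (fun y => f y * h y) z = D f z * h z + f z * D h z := by
  obtain ⟨v, w, hD⟩ := hD
  simp only [hD, fderiv_fun_mul hf hh, add_apply, smul_apply, smul_eq_mul]
  ring

theorem const_mul (hD : IsConstantVectorField D) (c : ℂ) (hf : DifferentiableAt ℝ f z) :
    D (fun y => c * f y) z = c * D f z := by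
  rw [hD.mul (differentiableAt_const c) hf, hD.const, zero_mul, zero_add]

theorem sub (hD : IsConstantVectorField D) (hf : DifferentiableAt ℝ f z)
    (hh : DifferentiableAt ℝ h z) : D (fun y => f y - h y) z = D f z - D h z := by
  obtain ⟨v, w, hD⟩ := hD
  simp only [hD, fderiv_fun_sub hf hh, sub_apply]
  ring

theorem sum (hD : IsConstantVectorField D) {ι : Type*} {s : Finset ι} {F : ι → E → ℂ}
    (hF : ∀ i ∈ s, DifferentiableAt ℝ (F i) z) :
    D (fun y => ∑ i ∈ s, F i y) z = ∑ i ∈ s, D (F i) z := by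
  obtain ⟨v, w, hD⟩ := hD
  simp only [hD, fderiv_fun_sum hF, sum_apply, Finset.mul_sum, Finset.sum_add_distrib]

theorem contDiffOn (hD : IsConstantVectorField D) (hU : IsOpen U) (hf : ContDiffOn ℝ ∞ f U) :
    ContDiffOn ℝ ∞ (D f) U := by
  obtain ⟨v, w, hD⟩ := hD
  rw [show D f = fun z => fderiv ℝ f z v + Complex.I * fderiv ℝ f z w from funext (hD f)]
  have hf' := hf.fderiv_of_isOpen hU (m := ∞) (by simp)
  exact (hf'.clm_apply contDiffOn_const).add
    (contDiffOn_const.mul (hf'.clm_apply contDiffOn_const))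

theorem support_subset (hD : IsConstantVectorField D) : Function.support (D f) ⊆ tsupport f := by
  obtain ⟨v, w, hD⟩ := hD
  intro x hx
  by_contra hxf
  exact hx (by simp [hD, fderiv_of_notMem_tsupport ℝ hxf])

theorem comm (hD : IsConstantVectorField D) (hD' : IsConstantVectorField D')
    (hf : ContDiffAt ℝ ∞ f z) : D (D' f) z = D' (D f) z := by
  obtain ⟨v, w, hD⟩ := hD
  obtain ⟨v', w', hD'⟩ := hD'
  have hdiff : DifferentiableAt ℝ (fderiv ℝ f) z :=
    (hf.fderiv_right (m := 1) (by norm_cast)).differentiableAt (by simp)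
  have hsymm : IsSymmSndFDerivAt ℝ f z :=
    hf.isSymmSndFDerivAt (by simpa using WithTop.coe_le_coe.2 (le_top (a := (2 : ℕ∞))))
  have happly : ∀ x, HasFDerivAt (fun y => fderiv ℝ f y x)
      ((fderiv ℝ (fderiv ℝ f) z).flip x) z := fun x => by
    simpa using hdiff.hasFDerivAt.clm_apply (hasFDerivAt_const x z)
  have hsecond : ∀ x y u, fderiv ℝ (fun p => fderiv ℝ f p x + Complex.I * fderiv ℝ f p y) z u
      = fderiv ℝ (fderiv ℝ f) z u x + Complex.I * fderiv ℝ (fderiv ℝ f) z u y := fun x y u => by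
    rw [((happly x).fun_add ((happly y).const_mul Complex.I)).fderiv]
    simp
  rw [hD, hD', funext (hD f), funext (hD' f)]
  simp only [hsecond, hsymm.eq v v', hsymm.eq v w', hsymm.eq w v', hsymm.eq w w']
  ring

theorem comp_of_hasDerivAt (hD : IsConstantVectorField D) {F : ℂ → ℂ} {F' : ℂ}
    (hF : HasDerivAt F F' (f z)) (hf : DifferentiableAt ℝ f z) :
    D (fun y => F (f y)) z = F' * D f z := by
  obtain ⟨v, w, hD⟩ := hD
  have hcomp : HasFDerivAt (fun y => F (f y)) _ z :=
    (hF.hasFDerivAt.restrictScalars ℝ).comp z hf.hasFDerivAt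
  simp only [hD, hcomp.fderiv, ContinuousLinearMap.comp_apply,
    ContinuousLinearMap.coe_restrictScalars', ContinuousLinearMap.toSpanSingleton_apply,
    smul_eq_mul]
  ring

theorem integral_eq_zero [FiniteDimensional ℝ E] [MeasurableSpace E] [BorelSpace E]
    (hD : IsConstantVectorField D) {μ : Measure E} [μ.IsAddHaarMeasure]
    (hf : ContDiff ℝ ∞ f) (hc : HasCompactSupport f) : ∫ z, D f z ∂μ = 0 := by
  have hint : ∀ u, Integrable (fun z => fderiv ℝ f z u) μ := fun u =>
    ((hf.continuous_fderiv (by simp)).clm_apply continuous_const).integrable_of_hasCompactSupport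
      (hc.fderiv_apply ℝ u)
  have hzero : ∀ u, ∫ z, fderiv ℝ f z u ∂μ = 0 := fun u => by
    simpa using integral_mul_fderiv_eq_neg_fderiv_mul_of_integrable (𝕜 := ℂ) (μ := μ)
      (f := fun _ : E => (1 : ℂ)) (g := f) (v := u) (by simp) (by simpa using hint u)
      (by simpa using hf.continuous.integrable_of_hasCompactSupport hc)
      (fun _ _ => differentiableAt_const _) (fun _ _ => hf.differentiable (by simp) _)
  obtain ⟨v, w, hD⟩ := hD
  simp only [hD]
  rw [integral_add (hint v) ((hint w).const_mul _), integral_const_mul, hzero, hzero]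
  simp

end IsConstantVectorField

theorem conj_dz (i : Fin n) (f : CSpace n → ℂ) (z : CSpace n) :
    conj (dz i f z) = dzbar i (fun y => conj (f y)) z := by
  have hconj : fderiv ℝ (fun y => conj (f y)) z = _ := Complex.conjCLE.comp_fderiv
  simp only [dz, dzbar, hconj, ContinuousLinearMap.comp_apply,
    ContinuousLinearEquiv.coe_coe, Complex.conjCLE_apply, map_mul, map_sub, map_div₀, map_one,
    Complex.conj_I, map_ofNat]
  ring

end Calculus

section MatrixCalculus

variable {E ι : Type*}

/-- Entrywise application of a differential operator to a matrix function. -/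
def matrixDeriv (D : (E → ℂ) → E → ℂ) (F : E → Matrix ι ι ℂ) (z : E) : Matrix ι ι ℂ :=
  Matrix.of fun j k => D (fun y => F y j k) z

variable {D : (E → ℂ) → E → ℂ} {F H : E → Matrix ι ι ℂ} {z : E} {U : Set E}

theorem matrixDeriv_apply (j k : ι) : matrixDeriv D F z j k = D (fun y => F y j k) z := rfl

variable [NormedAddCommGroup E] [NormedSpace ℝ E] [Fintype ι]

theorem matrixDeriv_mul (hD : IsConstantVectorField D)
    (hF : ∀ j k, DifferentiableAt ℝ (fun y => F y j k) z)
    (hH : ∀ j k, DifferentiableAt ℝ (fun y => H y j k) z) :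
    matrixDeriv D (fun y => F y * H y) z = matrixDeriv D F z * H z + F z * matrixDeriv D H z := by
  ext j k
  simp only [matrixDeriv_apply, Matrix.mul_apply, Matrix.add_apply]
  rw [hD.sum fun i _ => (hF j i).fun_mul (hH i k), ← Finset.sum_add_distrib]
  exact Finset.sum_congr rfl fun i _ => hD.mul (hF j i) (hH i k)

variable [DecidableEq ι]

theorem contDiffOn_det (hF : ∀ j k, ContDiffOn ℝ ∞ (fun z => F z j k) U) :
    ContDiffOn ℝ ∞ (fun z => (F z).det) U := by
  simp only [Matrix.det_apply']
  exact ContDiffOn.sum fun σ _ => contDiffOn_const.mul (contDiffOn_prod fun i _ => hF _ _)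

theorem contDiffOn_matrix_inv (hF : ∀ j k, ContDiffOn ℝ ∞ (fun z => F z j k) U)
    (hdet : ∀ z ∈ U, (F z).det ≠ 0) (j k : ι) : ContDiffOn ℝ ∞ (fun z => (F z)⁻¹ j k) U := by
  simp only [Matrix.inv_def, Matrix.smul_apply, Matrix.adjugate_apply, Ring.inverse_eq_inv',
    smul_eq_mul]
  refine ((contDiffOn_det hF).inv hdet).mul (contDiffOn_det fun i l => ?_)
  by_cases hi : i = k
  · subst hi
    simpa using contDiffOn_const
  · simpa [Matrix.updateRow_ne hi] using hF i l

theorem matrixDeriv_inv (hD : IsConstantVectorField D) (hU : IsOpen U)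
    (hF : ∀ j k, ContDiffOn ℝ ∞ (fun z => F z j k) U) (hdet : ∀ z ∈ U, (F z).det ≠ 0)
    (hz : z ∈ U) :
    matrixDeriv D (fun y => (F y)⁻¹) z = -((F z)⁻¹ * matrixDeriv D F z * (F z)⁻¹) := by
  have hdiff : ∀ {f : E → ℂ}, ContDiffOn ℝ ∞ f U → DifferentiableAt ℝ f z := fun hf =>
    (hf.contDiffAt (hU.mem_nhds hz)).differentiableAt (by simp)
  have hone : matrixDeriv D (fun y => F y * (F y)⁻¹) z = 0 := by
    ext j k
    rw [matrixDeriv_apply, hD.congr_of_eqOn hU (h := fun _ => (1 : Matrix ι ι ℂ) j k)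
      (fun y hy => by simp only [Matrix.mul_nonsing_inv _ (hdet y hy).isUnit]) hz, hD.const]
    rfl
  rw [matrixDeriv_mul hD (fun j k => hdiff (hF j k))
    (fun j k => hdiff (contDiffOn_matrix_inv hF hdet j k))] at hone
  simpa only [← mul_assoc, Matrix.nonsing_inv_mul _ (hdet z hz).isUnit, one_mul, mul_neg]
    using congrArg ((F z)⁻¹ * ·) (eq_neg_of_add_eq_zero_right hone)

theorem hasFDerivAt_det (hF : ∀ j k, DifferentiableAt ℝ (fun y => F y j k) z) :
    HasFDerivAt (fun y => (F y).det)
      (∑ i, ∑ j, (F z).adjugate j i • fderiv ℝ (fun y => F y i j) z) z := by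
  let detRows : ContinuousMultilinearMap ℝ (fun _ : ι => (ι → ℂ)) ℂ :=
    { toMultilinearMap :=
        (Matrix.detRowAlternating (n := ι) (R := ℂ)).toMultilinearMap.restrictScalars ℝ
      cont := continuous_id.matrix_det }
  have hrows : HasFDerivAt (fun y i j => F y i j) (ContinuousLinearMap.pi fun i =>
      ContinuousLinearMap.pi fun j => fderiv ℝ (fun y => F y i j) z) z :=
    hasFDerivAt_pi.2 fun i => hasFDerivAt_pi.2 fun j => (hF i j).hasFDerivAt
  refine ((detRows.hasFDerivAt _).comp z hrows).congr_fderiv (ContinuousLinearMap.ext fun u => ?_)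
  simp only [ContinuousLinearMap.comp_apply, ContinuousMultilinearMap.linearDeriv_apply,
    sum_apply, smul_apply, smul_eq_mul]
  refine Finset.sum_congr rfl fun i _ => ?_
  change ((F z).updateRow i fun j => fderiv ℝ (fun y => F y i j) z u).det = _
  rw [← Matrix.cramer_transpose_apply, Matrix.cramer_eq_adjugate_mulVec,
    ← Matrix.adjugate_transpose]
  rfl

theorem IsConstantVectorField.det (hD : IsConstantVectorField D)
    (hF : ∀ j k, DifferentiableAt ℝ (fun y => F y j k) z) (hdet : (F z).det ≠ 0) :
    D (fun y => (F y).det) z = (F z).det * ((F z)⁻¹ * matrixDeriv D F z).trace := by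
  obtain ⟨v, w, hD⟩ := hD
  have hinv : (F z).det • (F z)⁻¹ = (F z).adjugate := by
    rw [Matrix.inv_def, smul_smul, Ring.mul_inverse_cancel _ hdet.isUnit, one_smul]
  rw [← smul_eq_mul, ← Matrix.trace_smul, ← Matrix.smul_mul, hinv, hD, (hasFDerivAt_det hF).fderiv]
  simp only [sum_apply, smul_apply, smul_eq_mul, Matrix.trace, Matrix.diag_apply,
    Matrix.mul_apply, matrixDeriv_apply, hD, Finset.mul_sum, ← Finset.sum_add_distrib]
  rw [Finset.sum_comm]
  exact Finset.sum_congr rfl fun i _ => Finset.sum_congr rfl fun j _ => by ring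

end MatrixCalculus

section TestFunctions

variable {E : Type*} [NormedAddCommGroup E] [NormedSpace ℝ E]

/-- A test function on `U`: a smooth function with compact support contained in `U`. -/
structure IsTestFunction (U : Set E) (f : E → ℂ) : Prop where
  contDiff : ContDiff ℝ ∞ f
  hasCompactSupport : HasCompactSupport f
  tsupport_subset : tsupport f ⊆ U

namespace IsTestFunction

variable {U : Set E} {f F : E → ℂ} {D : (E → ℂ) → E → ℂ}

theorem comp_conj (hf : IsTestFunction U f) : IsTestFunction U fun z => conj (f z) where
  contDiff := Complex.conjCLE.contDiff.comp hf.contDiff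
  hasCompactSupport := hf.hasCompactSupport.comp_left (map_zero (starRingEnd ℂ))
  tsupport_subset := (tsupport_comp_subset (map_zero (starRingEnd ℂ)) f).trans hf.tsupport_subset

theorem deriv (hf : IsTestFunction U f) (hD : IsConstantVectorField D) :
    IsTestFunction U (D f) where
  contDiff := contDiffOn_univ.1 (hD.contDiffOn isOpen_univ hf.contDiff.contDiffOn)
  hasCompactSupport := hf.hasCompactSupport.mono' hD.support_subset
  tsupport_subset :=
    (closure_minimal hD.support_subset (isClosed_tsupport f)).trans hf.tsupport_subset

theorem mul (hf : IsTestFunction U f) (hU : IsOpen U) (hF : ContDiffOn ℝ ∞ F U) :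
    IsTestFunction U fun z => F z * f z := by
  have hsupp : tsupport (fun z => F z * f z) ⊆ tsupport f := tsupport_mul_subset_right
  refine ⟨contDiff_iff_contDiffAt.2 fun z => ?_,
    hf.hasCompactSupport.mono' ((subset_tsupport _).trans hsupp), hsupp.trans hf.tsupport_subset⟩
  by_cases hz : z ∈ tsupport f
  · exact (hF.contDiffAt (hU.mem_nhds (hf.tsupport_subset hz))).mul hf.contDiff.contDiffAt
  · refine (contDiffAt_const (c := (0 : ℂ))).congr_of_eventuallyEq ?_
    filter_upwards [(isClosed_tsupport f).isOpen_compl.mem_nhds hz] with y hy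
    rw [image_eq_zero_of_notMem_tsupport hy, mul_zero]

variable [MeasurableSpace E] [BorelSpace E] {μ : Measure E}

theorem integrable [IsFiniteMeasureOnCompacts μ] (hf : IsTestFunction U f) : Integrable f μ :=
  hf.contDiff.continuous.integrable_of_hasCompactSupport hf.hasCompactSupport

theorem setIntegral_mul_deriv [FiniteDimensional ℝ E] [μ.IsAddHaarMeasure]
    (hf : IsTestFunction U f) (hU : IsOpen U) (hF : ContDiffOn ℝ ∞ F U)
    (hD : IsConstantVectorField D) :
    ∫ z in U, F z * D f z ∂μ = -∫ z in U, D F z * f z ∂μ := by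
  have hFf := hf.mul hU hF
  have hzero : ∫ z in U, D (fun y => F y * f y) z ∂μ = 0 := by
    rw [setIntegral_eq_integral_of_forall_compl_eq_zero fun z hz =>
      image_eq_zero_of_notMem_tsupport fun h => hz ((hFf.deriv hD).tsupport_subset h),
      hD.integral_eq_zero hFf.contDiff hFf.hasCompactSupport]
  have hleibniz : Set.EqOn (D fun y => F y * f y) (fun z => D F z * f z + F z * D f z) U :=
    fun z hz => hD.mul ((hF.contDiffAt (hU.mem_nhds hz)).differentiableAt (by simp))
      (hf.contDiff.differentiable (by simp) z)
  rw [setIntegral_congr_fun hU.measurableSet hleibniz,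
    integral_add (hf.mul hU (hD.contDiffOn hU hF)).integrable.integrableOn
      ((hf.deriv hD).mul hU hF).integrable.integrableOn] at hzero
  exact eq_neg_of_add_eq_zero_right hzero

theorem setIntegral_sum_mul_deriv [FiniteDimensional ℝ E] [μ.IsAddHaarMeasure] {ι : Type*}
    {s : Finset ι} {D : ι → (E → ℂ) → E → ℂ} {F : ι → E → ℂ} (hf : IsTestFunction U f)
    (hU : IsOpen U) (hF : ∀ a, ContDiffOn ℝ ∞ (F a) U) (hD : ∀ a, IsConstantVectorField (D a)) :
    ∫ z in U, ∑ a ∈ s, F a z * D a f z ∂μ = -∫ z in U, (∑ a ∈ s, D a (F a) z) * f z ∂μ := by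
  simp only [Finset.sum_mul]
  rw [integral_finsetSum s fun a _ => ((hf.deriv (hD a)).mul hU (hF a)).integrable.integrableOn,
    integral_finsetSum s fun a _ =>
      (hf.mul hU ((hD a).contDiffOn hU (hF a))).integrable.integrableOn, ← Finset.sum_neg_distrib]
  exact Finset.sum_congr rfl fun a _ => hf.setIntegral_mul_deriv hU (hF a) (hD a)

end IsTestFunction

end TestFunctions

section KroneckerPower

variable {ι R : Type*} [CommSemiring R]

/-- The `r`-fold Kronecker power of a matrix, indexed by multi-indices; it describes the action of
the matrix on tensors with `r` indices. -/
def kroneckerPow (r : ℕ) (P : Matrix ι ι R) : Matrix (Fin r → ι) (Fin r → ι) R :=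
  Matrix.of fun A I => ∏ s, P (A s) (I s)

theorem kroneckerPow_apply {r : ℕ} (P : Matrix ι ι R) (A I : Fin r → ι) :
    kroneckerPow r P A I = ∏ s, P (A s) (I s) := rfl

theorem kroneckerPow_comp_perm {r : ℕ} (P : Matrix ι ι R) (A I : Fin r → ι)
    (σ : Equiv.Perm (Fin r)) : kroneckerPow r P (A ∘ σ) (I ∘ σ) = kroneckerPow r P A I :=
  Equiv.prod_comp σ fun s => P (A s) (I s)

theorem kroneckerPow_one [DecidableEq ι] (r : ℕ) : kroneckerPow r (1 : Matrix ι ι R) = 1 := by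
  ext A I
  simp only [kroneckerPow_apply, Matrix.one_apply, Finset.prod_ite_zero, Finset.prod_const_one,
    Finset.mem_univ, forall_const, funext_iff]

theorem kroneckerPow_mul [Fintype ι] (r : ℕ) (P Q : Matrix ι ι R) :
    kroneckerPow r (P * Q) = kroneckerPow r P * kroneckerPow r Q := by
  ext A I
  simp only [kroneckerPow_apply, Matrix.mul_apply, Fintype.prod_sum, ← Finset.prod_mul_distrib]

theorem kroneckerPow_cons {r : ℕ} (P : Matrix ι ι R) (a i : ι) (A I : Fin r → ι) :
    kroneckerPow (r + 1) P (Fin.cons a A) (Fin.cons i I) = P a i * kroneckerPow r P A I := by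
  simp [kroneckerPow_apply, Fin.prod_univ_succ]

theorem kroneckerPow_fin_one (P : Matrix ι ι R) (A I : Fin 1 → ι) :
    kroneckerPow 1 P A I = P (A 0) (I 0) := by
  simp [kroneckerPow_apply]

end KroneckerPower

section Metrics

variable {n : ℕ} {U : Set (CSpace n)} {G : CSpace n → Matrix (Fin n) (Fin n) ℂ} {z : CSpace n}

open scoped ComplexOrder in
/-- A smooth Hermitian metric in coordinates: a smooth field of positive definite Hermitian
matrices on an open set. -/
structure IsMetricOn (U : Set (CSpace n)) (G : CSpace n → Matrix (Fin n) (Fin n) ℂ) : Prop where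
  isOpen : IsOpen U
  smooth : ∀ j k, ContDiffOn ℝ ∞ (fun z => G z j k) U
  posDef : ∀ z ∈ U, (G z).PosDef

namespace IsMetricOn

theorem differentiableAt (hG : IsMetricOn U G) (hz : z ∈ U) {f : CSpace n → ℂ}
    (hf : ContDiffOn ℝ ∞ f U) : DifferentiableAt ℝ f z :=
  (hf.contDiffAt (hG.isOpen.mem_nhds hz)).differentiableAt (by simp)

open scoped ComplexOrder in
theorem det_ne_zero (hG : IsMetricOn U G) (hz : z ∈ U) : (G z).det ≠ 0 :=
  (hG.posDef z hz).det_pos.ne'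

open scoped ComplexOrder in
theorem conj_apply (hG : IsMetricOn U G) (hz : z ∈ U) (j k : Fin n) :
    conj (G z j k) = G z k j :=
  (hG.posDef z hz).isHermitian.apply k j

open scoped ComplexOrder in
theorem conj_inv_apply (hG : IsMetricOn U G) (hz : z ∈ U) (j k : Fin n) :
    conj ((G z)⁻¹ j k) = (G z)⁻¹ k j :=
  (hG.posDef z hz).isHermitian.inv.apply k j

open scoped ComplexOrder in
theorem conj_det (hG : IsMetricOn U G) (hz : z ∈ U) : conj (G z).det = (G z).det := by
  rw [← Complex.star_def, ← Matrix.det_conjTranspose, (hG.posDef z hz).isHermitian]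

theorem contDiffOn_inv (hG : IsMetricOn U G) (j k : Fin n) :
    ContDiffOn ℝ ∞ (fun z => (G z)⁻¹ j k) U :=
  contDiffOn_matrix_inv hG.smooth (fun _ hz => hG.det_ne_zero hz) j k

theorem mul_inv (hG : IsMetricOn U G) (hz : z ∈ U) : G z * (G z)⁻¹ = 1 :=
  Matrix.mul_nonsing_inv _ (hG.det_ne_zero hz).isUnit

theorem inv_mul (hG : IsMetricOn U G) (hz : z ∈ U) : (G z)⁻¹ * G z = 1 :=
  Matrix.nonsing_inv_mul _ (hG.det_ne_zero hz).isUnit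

end IsMetricOn

end Metrics

section IndexTransform

variable {n p q : ℕ} {P R G : CSpace n → Matrix (Fin n) (Fin n) ℂ} {z : CSpace n}

/-- The action of a matrix function on all indices of a form: for a `(1,1)`-form with component
matrix `A` this is `P * A * P`. It raises indices when `P = G⁻¹` and lowers them when `P = G`. -/
def indexTransform (P : CSpace n → Matrix (Fin n) (Fin n) ℂ) (α : CForm n p q) : CForm n p q :=
  fun z => kroneckerPow p (P z) * Matrix.of (α z) * kroneckerPow q (P z)

theorem indexTransform_apply (α : CForm n p q) (A : Fin p → Fin n) (B : Fin q → Fin n) :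
    indexTransform P α z A B
      = ∑ I, ∑ J, kroneckerPow p (P z) A I * kroneckerPow q (P z) J B * α z I J := by
  simp only [indexTransform, Matrix.mul_apply, Matrix.of_apply, Finset.sum_mul]
  rw [Finset.sum_comm]
  exact Finset.sum_congr rfl fun I _ => Finset.sum_congr rfl fun J _ => by ring

theorem indexTransform_sub (α β : CForm n p q) :
    indexTransform P (α - β) = indexTransform P α - indexTransform P β := by
  funext z A B
  simp only [indexTransform_apply, Pi.sub_apply, mul_sub, Finset.sum_sub_distrib]

theorem indexTransform_cons (β : CForm n (p + 1) q) (a : Fin n) (A : Fin p → Fin n)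
    (B : Fin q → Fin n) :
    indexTransform P β z (Fin.cons a A) B
      = ∑ i, P z a i * indexTransform P (fun y I J => β y (Fin.cons i I) J) z A B := by
  simp only [indexTransform_apply, Finset.mul_sum]
  rw [← (Fin.consEquiv fun _ => Fin n).sum_comp, Fintype.sum_prod_type]
  refine Finset.sum_congr rfl fun i _ => Finset.sum_congr rfl fun I _ =>
    Finset.sum_congr rfl fun J _ => ?_
  rw [← mul_assoc, ← mul_assoc]
  exact congrArg (· * _ * _) (kroneckerPow_cons _ a i A I)

theorem indexTransform_indexTransform (h : P z * R z = 1) (α : CForm n p q) :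
    indexTransform P (indexTransform R α) z = α z := by
  have hmatrix : kroneckerPow p (P z) * (kroneckerPow p (R z) * Matrix.of (α z) *
      kroneckerPow q (R z)) * kroneckerPow q (P z) = Matrix.of (α z) := by
    simp only [← Matrix.mul_assoc]
    rw [← kroneckerPow_mul, h, kroneckerPow_one, Matrix.one_mul, Matrix.mul_assoc,
      ← kroneckerPow_mul, mul_eq_one_comm.1 h, kroneckerPow_one, Matrix.mul_one]
  exact hmatrix

/-- The tensor obtained from a form by raising all of its indices with the metric. -/
abbrev sharp (G : CSpace n → Matrix (Fin n) (Fin n) ℂ) (α : CForm n p q) : CForm n p q :=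
  indexTransform (fun z => (G z)⁻¹) α

theorem formInner_eq_sum_sharp (α β : CForm n p q) :
    formInner G α β z = (1 / ((p.factorial : ℂ) * (q.factorial : ℂ))) *
      ∑ A, ∑ B, sharp G α z A B * conj (β z A B) := by
  rw [formInner, Finset.sum_comm]
  refine congrArg _ (Finset.sum_congr rfl fun A _ => ?_)
  simp only [indexTransform_apply, Finset.sum_mul]
  conv_rhs => rw [Finset.sum_comm]
  refine Finset.sum_congr rfl fun I _ => ?_
  rw [Finset.sum_comm]
  exact Finset.sum_congr rfl fun B _ => Finset.sum_congr rfl fun J _ =>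
    (mul_assoc (_ * _ : ℂ) _ _).symm

end IndexTransform

section SmoothForms

variable {n p q : ℕ} {U : Set (CSpace n)} {z : CSpace n}

theorem contDiffOn_kroneckerPow {P : CSpace n → Matrix (Fin n) (Fin n) ℂ}
    (hP : ∀ j k, ContDiffOn ℝ ∞ (fun z => P z j k) U) (A I : Fin p → Fin n) :
    ContDiffOn ℝ ∞ (fun z => kroneckerPow p (P z) A I) U :=
  contDiffOn_prod (t := Finset.univ) fun s _ => hP (A s) (I s)

namespace IsSmoothForm

theorem sub {α β : CForm n p q} (hα : IsSmoothForm U α) (hβ : IsSmoothForm U β) :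
    IsSmoothForm U (α - β) where
  smooth I J := (hα.smooth I J).sub (hβ.smooth I J)
  alternating_left z hz I J σ := by
    simp only [Pi.sub_apply, hα.alternating_left z hz, hβ.alternating_left z hz, mul_sub]
  alternating_right z hz I J σ := by
    simp only [Pi.sub_apply, hα.alternating_right z hz, hβ.alternating_right z hz, mul_sub]

theorem const_smul {α : CForm n p q} (hα : IsSmoothForm U α) (c : ℂ) :
    IsSmoothForm U (c • α) where
  smooth I J := contDiffOn_const.mul (hα.smooth I J)
  alternating_left z hz I J σ := by
    simp only [Pi.smul_apply, smul_eq_mul, hα.alternating_left z hz, mul_left_comm]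
  alternating_right z hz I J σ := by
    simp only [Pi.smul_apply, smul_eq_mul, hα.alternating_right z hz, mul_left_comm]

theorem indexTransform {P : CSpace n → Matrix (Fin n) (Fin n) ℂ}
    (hP : ∀ j k, ContDiffOn ℝ ∞ (fun z => P z j k) U) {α : CForm n p q} (hα : IsSmoothForm U α) :
    IsSmoothForm U (indexTransform P α) where
  smooth A B := by
    simp only [indexTransform_apply]
    exact ContDiffOn.sum fun I _ => ContDiffOn.sum fun J _ =>
      ((contDiffOn_kroneckerPow hP A I).mul (contDiffOn_kroneckerPow hP J B)).mul
        (hα.smooth I J)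
  alternating_left z hz A B σ := by
    simp only [indexTransform_apply, Finset.mul_sum]
    rw [← (σ.symm.arrowCongr (Equiv.refl (Fin n))).sum_comp]
    refine Finset.sum_congr rfl fun I _ => Finset.sum_congr rfl fun J _ => ?_
    rw [mul_left_comm, ← hα.alternating_left z hz]
    exact congrArg (· * _ * _) (kroneckerPow_comp_perm _ A I σ)
  alternating_right z hz A B σ := by
    simp only [indexTransform_apply, Finset.mul_sum]
    refine Finset.sum_congr rfl fun I _ => ?_
    rw [← (σ.symm.arrowCongr (Equiv.refl (Fin n))).sum_comp]
    refine Finset.sum_congr rfl fun J _ => ?_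
    rw [mul_left_comm, ← hα.alternating_right z hz]
    exact congrArg (_ * · * _) (kroneckerPow_comp_perm _ J B σ)

end IsSmoothForm

end SmoothForms

section TestForms

variable {n p q p' q' : ℕ} {U : Set (CSpace n)} {G : CSpace n → Matrix (Fin n) (Fin n) ℂ}
  {z : CSpace n}

theorem IsTestForm.isTestFunction {γ : CForm n p q} (hγ : IsTestForm U γ) (I : Fin p → Fin n)
    (J : Fin q → Fin n) : IsTestFunction U fun z => γ z I J :=
  ⟨contDiffOn_univ.1 (hγ.form.smooth I J), hγ.compact I J, hγ.support I J⟩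

theorem IsSmoothForm.isTestForm_mul {α : CForm n p q} (hα : IsSmoothForm U α) (hU : IsOpen U)
    {χ : CSpace n → ℂ} (hχ : IsTestFunction U χ) : IsTestForm U fun z I J => α z I J * χ z := by
  have htest : ∀ I J, IsTestFunction U fun z => α z I J * χ z := fun I J =>
    hχ.mul hU (hα.smooth I J)
  have hzero : ∀ z ∉ U, χ z = 0 := fun z hz =>
    image_eq_zero_of_notMem_tsupport fun h => hz (hχ.tsupport_subset h)
  refine ⟨⟨fun I J => (htest I J).contDiff.contDiffOn, fun z _ I J σ => ?_, fun z _ I J σ => ?_⟩,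
    fun I J => (htest I J).hasCompactSupport, fun I J => (htest I J).tsupport_subset⟩
  · by_cases hz : z ∈ U
    · rw [hα.alternating_left z hz, mul_assoc]
    · simp [hzero z hz]
  · by_cases hz : z ∈ U
    · rw [hα.alternating_right z hz, mul_assoc]
    · simp [hzero z hz]

namespace IsMetricOn

theorem isTestFunction_sharp_mul (hG : IsMetricOn U G) {α γ : CForm n p q}
    (hα : IsSmoothForm U α) (hγ : IsTestForm U γ) (A : Fin p → Fin n) (B : Fin q → Fin n) :
    IsTestFunction U fun z => sharp G α z A B * (G z).det * conj (γ z A B) :=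
  (hγ.isTestFunction A B).comp_conj.mul hG.isOpen
    (((hα.indexTransform hG.contDiffOn_inv).smooth A B).mul (contDiffOn_det hG.smooth))

theorem l2Inner_eq_sum_integral (hG : IsMetricOn U G) {α γ : CForm n p q}
    (hα : IsSmoothForm U α) (hγ : IsTestForm U γ) :
    l2Inner U G α γ = (1 / ((p.factorial : ℂ) * (q.factorial : ℂ))) *
      ∑ A, ∑ B, ∫ z in U, sharp G α z A B * (G z).det * conj (γ z A B) := by
  have hint : ∀ A B, Integrable (fun z => sharp G α z A B * (G z).det * conj (γ z A B))
      (volume.restrict U) := fun A B =>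
    (hG.isTestFunction_sharp_mul hα hγ A B).integrable.integrableOn
  have hpoint : ∀ z, formInner G α γ z * (G z).det
      = (1 / ((p.factorial : ℂ) * (q.factorial : ℂ))) *
        ∑ A, ∑ B, sharp G α z A B * (G z).det * conj (γ z A B) := fun z => by
    rw [formInner_eq_sum_sharp, mul_assoc, Finset.sum_mul]
    simp only [Finset.sum_mul, mul_right_comm]
  simp only [l2Inner, hpoint, integral_const_mul]
  rw [integral_finsetSum _ fun A _ => integrable_finsetSum _ fun B _ => hint A B]
  exact congrArg _ (Finset.sum_congr rfl fun A _ => integral_finsetSum _ fun B _ => hint A B)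

theorem l2Inner_sub (hG : IsMetricOn U G) {α β γ : CForm n p q} (hα : IsSmoothForm U α)
    (hβ : IsSmoothForm U β) (hγ : IsTestForm U γ) :
    l2Inner U G (α - β) γ = l2Inner U G α γ - l2Inner U G β γ := by
  have hint : ∀ {α : CForm n p q}, IsSmoothForm U α → ∀ A B,
      IntegrableOn (fun z => sharp G α z A B * (G z).det * conj (γ z A B)) U := fun hα A B =>
    (hG.isTestFunction_sharp_mul hα hγ A B).integrable.integrableOn
  rw [hG.l2Inner_eq_sum_integral (hα.sub hβ) hγ, hG.l2Inner_eq_sum_integral hα hγ,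
    hG.l2Inner_eq_sum_integral hβ hγ, ← mul_sub, ← Finset.sum_sub_distrib]
  simp only [← Finset.sum_sub_distrib, ← integral_sub (hint hα _ _) (hint hβ _ _),
    indexTransform_sub, Pi.sub_apply, sub_mul]

theorem eq_zero_of_formInner_sharp_self_eq_zero (hG : IsMetricOn U G) (hz : z ∈ U)
    {α : CForm n p q} (h : formInner G α (sharp G α) z = 0) : α z = 0 := by
  have hsum : ∑ A, ∑ B, Complex.normSq (sharp G α z A B) = 0 := by
    simpa [formInner_eq_sum_sharp, Nat.factorial_ne_zero, Complex.mul_conj,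
      ← Complex.ofReal_sum] using h
  have hsharp : sharp G α z = 0 := by
    funext A B
    have hA := (Finset.sum_eq_zero_iff_of_nonneg fun A _ =>
      Finset.sum_nonneg fun B _ => Complex.normSq_nonneg _).1 hsum A (Finset.mem_univ A)
    exact Complex.normSq_eq_zero.1 ((Finset.sum_eq_zero_iff_of_nonneg fun B _ =>
      Complex.normSq_nonneg _).1 hA B (Finset.mem_univ B))
  have hlower : indexTransform G (sharp G α) z = α z :=
    indexTransform_indexTransform (R := fun z => (G z)⁻¹) (hG.mul_inv hz) α
  funext A B
  rw [← hlower, indexTransform_apply]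
  simp [hsharp]

theorem contDiffOn_formInner (hG : IsMetricOn U G) {α β : CForm n p q} (hα : IsSmoothForm U α)
    (hβ : IsSmoothForm U β) : ContDiffOn ℝ ∞ (formInner G α β) U := by
  rw [funext fun z => formInner_eq_sum_sharp (G := G) (z := z) α β]
  exact contDiffOn_const.mul (ContDiffOn.sum fun A _ => ContDiffOn.sum fun B _ =>
    ((hα.indexTransform hG.contDiffOn_inv).smooth A B).mul
      (Complex.conjCLE.contDiff.comp_contDiffOn (hβ.smooth A B)))

/-- Testing against `χ • α♯` localizes `(α, α♯)`, whose integrand is a multiple of `∑ |α♯|²`. -/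
theorem eqOn_zero_of_l2Inner_eq_zero (hG : IsMetricOn U G) {α : CForm n p q}
    (hα : IsSmoothForm U α) (h : ∀ γ, IsTestForm U γ → l2Inner U G α γ = 0) :
    Set.EqOn α 0 U := by
  have hsharp : IsSmoothForm U (sharp G α) := hα.indexTransform hG.contDiffOn_inv
  have hcont : ContinuousOn (fun z => formInner G α (sharp G α) z * (G z).det) U :=
    ((hG.contDiffOn_formInner hα hsharp).mul (contDiffOn_det hG.smooth)).continuousOn
  have hae : ∀ᵐ z, z ∈ U → formInner G α (sharp G α) z * (G z).det = 0 := by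
    refine hG.isOpen.ae_eq_zero_of_integral_contDiff_smul_eq_zero
      (hcont.locallyIntegrableOn hG.isOpen.measurableSet) fun χ hχ hcompact hsupp => ?_
    have htest : IsTestFunction U fun z => (χ z : ℂ) :=
      ⟨Complex.ofRealCLM.contDiff.comp hχ, hcompact.comp_left Complex.ofReal_zero,
        (tsupport_comp_subset Complex.ofReal_zero χ).trans hsupp⟩
    rw [← h _ (hsharp.isTestForm_mul hG.isOpen htest), l2Inner,
      ← setIntegral_eq_integral_of_forall_compl_eq_zero (s := U) fun z hz => by
        rw [image_eq_zero_of_notMem_tsupport fun hz' => hz (hsupp hz'), zero_smul]]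
    refine integral_congr_ae (.of_forall fun z => ?_)
    simp only [formInner_eq_sum_sharp, map_mul, Complex.conj_ofReal, Complex.real_smul,
      ← mul_assoc, ← Finset.sum_mul]
    ring
  have hzero := Measure.eqOn_open_of_ae_eq
    ((ae_restrict_iff' hG.isOpen.measurableSet).2 hae) hG.isOpen hcont continuousOn_const
  exact fun z hz => hG.eq_zero_of_formInner_sharp_self_eq_zero hz
    ((mul_eq_zero_iff_right (hG.det_ne_zero hz)).1 (hzero hz))

end IsMetricOn

variable {D : CForm n p q → CForm n p' q'} {β : CForm n p' q'} {η η' : CForm n p q}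

theorem IsL2Adjoint.eqOn (hG : IsMetricOn U G) (h : IsL2Adjoint U G D β η)
    (h' : IsL2Adjoint U G D β η') : Set.EqOn η η' U := by
  intro z hz
  refine sub_eq_zero.1 (hG.eqOn_zero_of_l2Inner_eq_zero (h.smooth.sub h'.smooth)
    (fun γ hγ => ?_) hz)
  rw [hG.l2Inner_sub h.smooth h'.smooth hγ, h.adjoint γ hγ, h'.adjoint γ hγ, sub_self]

theorem IsL2Adjoint.hasUniqueL2Adjoint (hG : IsMetricOn U G) (h : IsL2Adjoint U G D β η) :
    HasUniqueL2Adjoint U G D β :=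
  ⟨⟨η, h⟩, fun _ _ h₁ h₂ => h₁.eqOn hG h₂⟩

theorem IsL2Adjoint.eqOn_l2Adjoint (hG : IsMetricOn U G) (h : IsL2Adjoint U G D β η) :
    Set.EqOn (l2Adjoint U G D β) η U := by
  have hex : ∃ η, IsL2Adjoint U G D β η := ⟨η, h⟩
  rw [l2Adjoint, dif_pos hex]
  exact hex.choose_spec.eqOn hG h

end TestForms

section Alternation

variable {ι R : Type*} [CommRing R] {p : ℕ}

/-- A function of multi-indices is alternating if permuting the indices multiplies its value by
the sign of the permutation. -/
def IsAlternating (f : (Fin p → ι) → R) : Prop :=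
  ∀ I (σ : Equiv.Perm (Fin p)), f (I ∘ σ) = ((Equiv.Perm.sign σ : ℤ) : R) * f I

theorem exists_perm_succAbove (σ : Equiv.Perm (Fin (p + 1))) (k : Fin (p + 1)) :
    ∃ τ : Equiv.Perm (Fin p), (∀ s, σ (k.succAbove s) = (σ k).succAbove (τ s)) ∧
      ((Equiv.Perm.sign τ : ℤ)) = (-1) ^ (k : ℕ) * (-1) ^ (σ k : ℕ) * Equiv.Perm.sign σ := by
  obtain ⟨⟨a, τ⟩, hτ⟩ := Equiv.Perm.decomposeFin.symm.surjective
    ((σ k).cycleRange * σ * k.cycleRange.symm)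
  obtain rfl : a = 0 := by
    rw [← Equiv.Perm.decomposeFin_symm_apply_zero a τ, hτ]
    simp [Equiv.Perm.mul_apply]
  refine ⟨τ, fun s => ?_, ?_⟩
  · have hs := congrArg (fun ρ : Equiv.Perm _ => (σ k).cycleRange.symm (ρ s.succ)) hτ
    simpa [Equiv.Perm.mul_apply] using hs.symm
  · have hsign := congrArg Equiv.Perm.sign hτ
    rw [Equiv.Perm.decomposeFin.symm_sign] at hsign
    simp only [if_true, one_mul, map_mul, Fin.sign_cycleRange, Equiv.Perm.sign_symm] at hsign
    rw [hsign]
    push_cast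
    ring

namespace IsAlternating

variable {f : (Fin (p + 1) → ι) → R}

theorem apply_insertNth (hf : IsAlternating f) (k : Fin (p + 1)) (a : ι) (A : Fin p → ι) :
    f (k.insertNth a A) = (-1) ^ (k : ℕ) * f (Fin.cons a A) := by
  have hcons := hf (Fin.cons a A) k.cycleRange
  simpa only [Fin.cons_comp_cycleRange, Fin.sign_cycleRange, Units.val_pow_eq_pow_val,
    Units.val_neg, Units.val_one, Int.cast_pow, Int.cast_neg, Int.cast_one] using hcons

theorem cons (hf : IsAlternating f) (a : ι) : IsAlternating fun A => f (Fin.cons a A) := by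
  intro A σ
  have hcomp : Fin.cons a A ∘ Equiv.Perm.decomposeFin.symm (0, σ)
      = (Fin.cons a (A ∘ σ) : Fin (p + 1) → ι) := by
    funext s
    refine Fin.cases ?_ (fun s => ?_) s <;> simp
  have hsign := hf (Fin.cons a A) (Equiv.Perm.decomposeFin.symm (0, σ))
  rwa [hcomp, Equiv.Perm.decomposeFin.symm_sign, if_pos rfl, one_mul] at hsign

theorem sum_removeNth {F : ι → (Fin p → ι) → R} (hF : ∀ a, IsAlternating (F a)) :
    IsAlternating fun I : Fin (p + 1) → ι =>
      ∑ k : Fin (p + 1), (-1) ^ (k : ℕ) * F (I k) (k.removeNth I) := by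
  intro I σ
  rw [Finset.mul_sum, ← Equiv.sum_comp σ]
  refine Finset.sum_congr rfl fun k _ => ?_
  obtain ⟨τ, hτ, hsign⟩ := exists_perm_succAbove σ k
  have hremove : k.removeNth (I ∘ σ) = (σ k).removeNth I ∘ τ :=
    funext fun s => congrArg I (hτ s)
  have hone : ((-1 : R) ^ (k : ℕ)) * (-1) ^ (k : ℕ) = 1 :=
    pow_mul_pow_eq_one _ (by simp)
  rw [hremove, hF, hsign]
  push_cast
  simp only [Function.comp_apply]
  linear_combination ((-1) ^ (σ k : ℕ) * (Equiv.Perm.sign σ : ℤ)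
    * F (I (σ k)) ((σ k).removeNth I)) * hone

theorem sum_mul_sum_removeNth [Fintype ι] (hf : IsAlternating f) (F : ι → (Fin p → ι) → R) :
    ∑ I, f I * ∑ k : Fin (p + 1), (-1) ^ (k : ℕ) * F (I k) (k.removeNth I)
      = (p + 1) * ∑ A, ∑ a, f (Fin.cons a A) * F a A := by
  have hk : ∀ k : Fin (p + 1), ∑ I, f I * ((-1) ^ (k : ℕ) * F (I k) (k.removeNth I))
      = ∑ A, ∑ a, f (Fin.cons a A) * F a A := fun k => by
    rw [← (Fin.insertNthEquiv (fun _ => ι) k).sum_comp, Fintype.sum_prod_type_right]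
    refine Finset.sum_congr rfl fun A _ => Finset.sum_congr rfl fun a _ => ?_
    have hone : ((-1 : R) ^ (k : ℕ)) * (-1) ^ (k : ℕ) = 1 :=
      pow_mul_pow_eq_one _ (by simp)
    have hinsert : Fin.insertNthEquiv (fun _ => ι) k (a, A) = k.insertNth a A := rfl
    rw [hinsert, Fin.insertNth_apply_same, Fin.removeNth_insertNth, hf.apply_insertNth]
    linear_combination (f (Fin.cons a A) * F a A) * hone
  simp only [Finset.mul_sum (s := Finset.univ (α := Fin (p + 1)))]
  rw [Finset.sum_comm, Finset.sum_congr rfl fun k _ => hk k]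
  simp

end IsAlternating

end Alternation

section ExteriorDerivative

variable {n p q : ℕ} {U : Set (CSpace n)} {G : CSpace n → Matrix (Fin n) (Fin n) ℂ}
  {z : CSpace n}

namespace IsSmoothForm

variable {α : CForm n p q}

theorem isAlternating_left (hα : IsSmoothForm U α) (hz : z ∈ U) (J : Fin q → Fin n) :
    IsAlternating fun I => α z I J :=
  fun I σ => hα.alternating_left z hz I J σ

theorem differentiableAt (hα : IsSmoothForm U α) (hU : IsOpen U) (hz : z ∈ U)
    (I : Fin p → Fin n) (J : Fin q → Fin n) : DifferentiableAt ℝ (fun y => α y I J) z :=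
  ((hα.smooth I J).contDiffAt (hU.mem_nhds hz)).differentiableAt (by simp)

theorem isAlternating_deriv {D : (CSpace n → ℂ) → CSpace n → ℂ} (hα : IsSmoothForm U α)
    (hU : IsOpen U) (hz : z ∈ U) (hD : IsConstantVectorField D) (J : Fin q → Fin n) :
    IsAlternating fun I => D (fun y => α y I J) z := by
  intro I σ
  rw [← hD.const_mul _ (hα.differentiableAt hU hz I J)]
  exact hD.congr_of_eqOn hU (fun y hy => hα.alternating_left y hy I J σ) hz

theorem del (hα : IsSmoothForm U α) (hU : IsOpen U) : IsSmoothForm U (del α) where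
  smooth I J := ContDiffOn.sum fun k _ =>
    contDiffOn_const.mul ((isConstantVectorField_dz (I k)).contDiffOn hU (hα.smooth _ J))
  alternating_left z hz I J := IsAlternating.sum_removeNth
    (fun a => hα.isAlternating_deriv hU hz (isConstantVectorField_dz a) J) I
  alternating_right z hz I J σ := by
    rw [HermitianFlow.del, HermitianFlow.del, Finset.mul_sum]
    refine Finset.sum_congr rfl fun k _ => ?_
    have hdz := isConstantVectorField_dz (I k)
    rw [mul_left_comm, ← hdz.const_mul _ (hα.differentiableAt hU hz _ J)]
    exact congrArg _ (hdz.congr_of_eqOn hU (fun y hy => hα.alternating_right y hy _ J σ) hz)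

end IsSmoothForm

theorem formInner_del {β : CForm n (p + 1) q} (hG : IsMetricOn U G) (hβ : IsSmoothForm U β)
    (hz : z ∈ U) (γ : CForm n p q) :
    formInner G β (del γ) z = (1 / ((p.factorial : ℂ) * (q.factorial : ℂ))) *
      ∑ A, ∑ B, ∑ a, sharp G β z (Fin.cons a A) B * conj (dz a (fun y => γ y A B) z) := by
  have hB : ∀ B, ∑ I, sharp G β z I B * conj (del γ z I B)
      = (p + 1) * ∑ A, ∑ a, sharp G β z (Fin.cons a A) B *
        conj (dz a (fun y => γ y A B) z) := fun B => by
    rw [← ((hβ.indexTransform hG.contDiffOn_inv).isAlternating_left hz B).sum_mul_sum_removeNth]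
    simp only [del, map_sum, map_mul, map_pow, map_neg, map_one]
    rfl
  have hp : ((p : ℂ) + 1) ≠ 0 := Nat.cast_add_one_ne_zero p
  rw [formInner_eq_sum_sharp, Finset.sum_comm, Finset.sum_congr rfl fun B _ => hB B,
    ← Finset.mul_sum, Finset.sum_comm, Nat.factorial_succ]
  push_cast
  field_simp

/-- The coordinate expression of `∂*β`. Its fully raised components are
`-(det g)⁻¹ ∑ₐ ∂_ā (det g · β♯(a, A, B))`, as one finds by integrating `(β, ∂γ)` by parts. -/
def delAdjoint (G : CSpace n → Matrix (Fin n) (Fin n) ℂ) (β : CForm n (p + 1) q) : CForm n p q :=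
  indexTransform G fun z A B =>
    -(G z).det⁻¹ * ∑ a, dzbar a (fun y => sharp G β y (Fin.cons a A) B * (G y).det) z

namespace IsMetricOn

variable {β : CForm n (p + 1) q}

theorem contDiffOn_sharp_mul_det (hG : IsMetricOn U G) (hβ : IsSmoothForm U β)
    (I : Fin (p + 1) → Fin n) (B : Fin q → Fin n) :
    ContDiffOn ℝ ∞ (fun y => sharp G β y I B * (G y).det) U :=
  ((hβ.indexTransform hG.contDiffOn_inv).smooth I B).mul (contDiffOn_det hG.smooth)

theorem sharp_delAdjoint (hG : IsMetricOn U G) (hz : z ∈ U) (β : CForm n (p + 1) q)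
    (A : Fin p → Fin n) (B : Fin q → Fin n) :
    sharp G (delAdjoint G β) z A B
      = -(G z).det⁻¹ * ∑ a, dzbar a (fun y => sharp G β y (Fin.cons a A) B * (G y).det) z := by
  rw [sharp, delAdjoint, indexTransform_indexTransform (hG.inv_mul hz)]

theorem isSmoothForm_delAdjoint (hG : IsMetricOn U G) (hβ : IsSmoothForm U β) :
    IsSmoothForm U (delAdjoint G β) := by
  have hsharp : IsSmoothForm U (sharp G β) := hβ.indexTransform hG.contDiffOn_inv
  have hdiv : ∀ {z}, z ∈ U → ∀ (c : ℂ) {F F' : Fin n → CSpace n → ℂ},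
      (∀ a, ContDiffOn ℝ ∞ (F a) U) → (∀ a, Set.EqOn (F' a) (fun y => c * F a y) U) →
      -(G z).det⁻¹ * ∑ a, dzbar a (F' a) z = c * (-(G z).det⁻¹ * ∑ a, dzbar a (F a) z) := by
    intro z hz c F F' hF hFF'
    have hterm : ∀ a, dzbar a (F' a) z = c * dzbar a (F a) z := fun a => by
      rw [(isConstantVectorField_dzbar a).congr_of_eqOn hG.isOpen (hFF' a) hz,
        (isConstantVectorField_dzbar a).const_mul _ (hG.differentiableAt hz (hF a))]
    rw [Finset.sum_congr rfl fun a _ => hterm a, ← Finset.mul_sum, mul_left_comm]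
  refine IsSmoothForm.indexTransform hG.smooth ⟨fun A B => ?_, fun z hz A B σ =>
    hdiv hz _ (fun a => hG.contDiffOn_sharp_mul_det hβ _ B) fun a y hy => ?_, fun z hz A B σ =>
    hdiv hz _ (fun a => hG.contDiffOn_sharp_mul_det hβ _ B) fun a y hy => ?_⟩
  · exact ((contDiffOn_det hG.smooth).inv fun z hz => hG.det_ne_zero hz).neg.mul
      (ContDiffOn.sum fun a _ => (isConstantVectorField_dzbar a).contDiffOn hG.isOpen
        (hG.contDiffOn_sharp_mul_det hβ _ B))
  · exact (congrArg (· * _) ((hsharp.isAlternating_left hy B).cons a A σ)).trans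
      (mul_assoc _ _ _)
  · exact (congrArg (· * _) (hsharp.alternating_right y hy _ B σ)).trans (mul_assoc _ _ _)

theorem l2Inner_del (hG : IsMetricOn U G) (hβ : IsSmoothForm U β) {γ : CForm n p q}
    (hγ : IsTestForm U γ) :
    l2Inner U G β (del γ) = (1 / ((p.factorial : ℂ) * (q.factorial : ℂ))) *
      ∑ A, ∑ B, ∫ z in U, ∑ a, sharp G β z (Fin.cons a A) B * (G z).det *
        dzbar a (fun y => conj (γ y A B)) z := by
  have hint : ∀ A B, IntegrableOn (fun z => ∑ a, sharp G β z (Fin.cons a A) B * (G z).det *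
      dzbar a (fun y => conj (γ y A B)) z) U := fun A B =>
    integrable_finsetSum _ fun a _ =>
      (((hγ.isTestFunction A B).comp_conj.deriv (isConstantVectorField_dzbar a)).mul hG.isOpen
        (hG.contDiffOn_sharp_mul_det hβ (Fin.cons a A) B)).integrable.integrableOn
  have hpoint : ∀ z ∈ U, formInner G β (del γ) z * (G z).det
      = (1 / ((p.factorial : ℂ) * (q.factorial : ℂ))) *
        ∑ A, ∑ B, ∑ a, sharp G β z (Fin.cons a A) B * (G z).det *
          dzbar a (fun y => conj (γ y A B)) z := fun z hz => by
    simp only [formInner_del hG hβ hz, mul_assoc, Finset.sum_mul, conj_dz, mul_comm (G z).det]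
  rw [l2Inner, setIntegral_congr_fun hG.isOpen.measurableSet hpoint, integral_const_mul,
    integral_finsetSum _ fun A _ => integrable_finsetSum _ fun B _ => hint A B]
  exact congrArg _ (Finset.sum_congr rfl fun A _ => integral_finsetSum _ fun B _ => hint A B)

theorem isL2Adjoint_delAdjoint (hG : IsMetricOn U G) (hβ : IsSmoothForm U β) :
    IsL2Adjoint U G del β (delAdjoint G β) where
  smooth := hG.isSmoothForm_delAdjoint hβ
  adjoint γ hγ := by
    rw [hG.l2Inner_eq_sum_integral (hG.isSmoothForm_delAdjoint hβ) hγ, hG.l2Inner_del hβ hγ]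
    refine congrArg _ (Finset.sum_congr rfl fun A _ => Finset.sum_congr rfl fun B _ => ?_)
    rw [(hγ.isTestFunction A B).comp_conj.setIntegral_sum_mul_deriv hG.isOpen
      (fun a => hG.contDiffOn_sharp_mul_det hβ (Fin.cons a A) B) isConstantVectorField_dzbar,
      ← integral_neg]
    refine setIntegral_congr_fun hG.isOpen.measurableSet fun z hz => ?_
    simp only [hG.sharp_delAdjoint hz]
    field_simp [hG.det_ne_zero hz]

theorem hasUniqueL2Adjoint_del (hG : IsMetricOn U G) (hβ : IsSmoothForm U β) :
    HasUniqueL2Adjoint U G del β :=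
  (hG.isL2Adjoint_delAdjoint hβ).hasUniqueL2Adjoint hG

theorem eqOn_delStar (hG : IsMetricOn U G) (hβ : IsSmoothForm U β) :
    Set.EqOn (delStar U G β) (delAdjoint G β) U :=
  (hG.isL2Adjoint_delAdjoint hβ).eqOn_l2Adjoint hG

end IsMetricOn

end ExteriorDerivative

theorem sum_comm_pairs {α β γ δ M : Type*} [Fintype α] [Fintype β] [Fintype γ] [Fintype δ]
    [AddCommMonoid M] (f : α → β → γ → δ → M) :
    ∑ a, ∑ b, ∑ c, ∑ d, f a b c d = ∑ c, ∑ d, ∑ a, ∑ b, f a b c d := by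
  simpa only [Fintype.sum_prod_type] using
    Finset.sum_comm (s := .univ) (t := .univ)
      (f := fun (x : α × β) (y : γ × δ) => f x.1 x.2 y.1 y.2)

section Conjugation

variable {n p q : ℕ} {U : Set (CSpace n)} {G : CSpace n → Matrix (Fin n) (Fin n) ℂ}

/-- Complex conjugation of forms; it interchanges `∂` and `∂̄`. -/
def conjForm (α : CForm n p q) : CForm n q p := fun z I J => conj (α z J I)

theorem conjForm_conjForm (α : CForm n p q) : conjForm (conjForm α) = α := by
  funext z I J
  exact Complex.conj_conj _

theorem delbar_eq_smul_conjForm_del_conjForm (α : CForm n p q) :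
    delbar α = (-1 : ℂ) ^ p • conjForm (del (conjForm α)) := by
  funext z I J
  simp only [delbar, conjForm, del, Pi.smul_apply, smul_eq_mul, map_sum, map_mul, map_pow,
    map_neg, map_one, conj_dz, Complex.conj_conj]

theorem IsSmoothForm.conjForm {α : CForm n p q} (hα : IsSmoothForm U α) :
    IsSmoothForm U (conjForm α) where
  smooth I J := Complex.conjCLE.contDiff.comp_contDiffOn (hα.smooth J I)
  alternating_left z hz I J σ := by
    simp only [HermitianFlow.conjForm, hα.alternating_right z hz, map_mul, map_intCast]
  alternating_right z hz I J σ := by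
    simp only [HermitianFlow.conjForm, hα.alternating_left z hz, map_mul, map_intCast]

theorem IsTestForm.conjForm {γ : CForm n p q} (hγ : IsTestForm U γ) :
    IsTestForm U (conjForm γ) where
  form := hγ.form.conjForm
  compact I J := (hγ.isTestFunction J I).comp_conj.hasCompactSupport
  support I J := (hγ.isTestFunction J I).comp_conj.tsupport_subset

theorem l2Inner_smul_left (c : ℂ) (α γ : CForm n p q) :
    l2Inner U G (c • α) γ = c * l2Inner U G α γ := by
  rw [l2Inner, l2Inner, ← integral_const_mul]
  congr with z
  simp only [formInner, Pi.smul_apply, smul_eq_mul, Finset.mul_sum, Finset.sum_mul]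
  refine Finset.sum_congr rfl fun _ _ => Finset.sum_congr rfl fun _ _ =>
    Finset.sum_congr rfl fun _ _ => Finset.sum_congr rfl fun _ _ => ?_
  ring

theorem l2Inner_smul_right (c : ℂ) (α γ : CForm n p q) :
    l2Inner U G α (c • γ) = conj c * l2Inner U G α γ := by
  rw [l2Inner, l2Inner, ← integral_const_mul]
  congr with z
  simp only [formInner, Pi.smul_apply, smul_eq_mul, map_mul, Finset.mul_sum, Finset.sum_mul]
  refine Finset.sum_congr rfl fun _ _ => Finset.sum_congr rfl fun _ _ =>
    Finset.sum_congr rfl fun _ _ => Finset.sum_congr rfl fun _ _ => ?_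
  ring

namespace IsMetricOn

theorem formInner_conjForm (hG : IsMetricOn U G) {z : CSpace n} (hz : z ∈ U)
    (α γ : CForm n p q) :
    formInner G (conjForm α) (conjForm γ) z = conj (formInner G α γ z) := by
  have hinv : ∀ k l, conj (gInv G z k l) = gInv G z l k := fun k l => hG.conj_inv_apply hz l k
  simp only [formInner, conjForm, map_mul, map_sum, map_prod, hinv, map_div₀, map_one,
    map_natCast, Complex.conj_conj]
  rw [mul_comm (q.factorial : ℂ), sum_comm_pairs]
  refine congrArg _ (Finset.sum_congr rfl fun _ _ => Finset.sum_congr rfl fun _ _ =>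
    Finset.sum_congr rfl fun _ _ => Finset.sum_congr rfl fun _ _ => ?_)
  ring

theorem l2Inner_conjForm (hG : IsMetricOn U G) (α γ : CForm n p q) :
    l2Inner U G (conjForm α) (conjForm γ) = conj (l2Inner U G α γ) := by
  rw [l2Inner, l2Inner, ← integral_conj]
  refine setIntegral_congr_fun hG.isOpen.measurableSet fun z hz => ?_
  simp only [hG.formInner_conjForm hz, map_mul, hG.conj_det hz]

end IsMetricOn

namespace IsL2Adjoint

variable {p' q' : ℕ} {D : CForm n p q → CForm n p' q'} {β β' : CForm n p' q'} {η : CForm n p q}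

theorem const_smul (h : IsL2Adjoint U G D β η) (c : ℂ) : IsL2Adjoint U G D (c • β) (c • η) where
  smooth := h.smooth.const_smul c
  adjoint γ hγ := by rw [l2Inner_smul_left, l2Inner_smul_left, h.adjoint γ hγ]

theorem congr (hU : IsOpen U) (h : IsL2Adjoint U G D β η) (hβ : Set.EqOn β β' U) :
    IsL2Adjoint U G D β' η where
  smooth := h.smooth
  adjoint γ hγ := by
    rw [h.adjoint γ hγ]
    refine setIntegral_congr_fun hU.measurableSet fun z hz => ?_
    simp only [formInner, hβ hz]

theorem conjForm {β : CForm n (p + 1) q} {η : CForm n p q} (hG : IsMetricOn U G)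
    (h : IsL2Adjoint U G del β η) :
    IsL2Adjoint U G delbar (conjForm β) ((-1 : ℂ) ^ q • conjForm η) where
  smooth := h.smooth.conjForm.const_smul _
  adjoint γ hγ := by
    have hreal : conj ((-1 : ℂ) ^ q) = (-1) ^ q := by simp
    rw [delbar_eq_smul_conjForm_del_conjForm, l2Inner_smul_left, l2Inner_smul_right, hreal,
      hG.l2Inner_conjForm, ← h.adjoint _ hγ.conjForm, ← hG.l2Inner_conjForm, conjForm_conjForm]

end IsL2Adjoint

theorem IsMetricOn.hasUniqueL2Adjoint_delbar (hG : IsMetricOn U G) {β : CForm n p (q + 1)}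
    (hβ : IsSmoothForm U β) : HasUniqueL2Adjoint U G delbar β := by
  have h := (hG.isL2Adjoint_delAdjoint hβ.conjForm).conjForm hG
  rw [conjForm_conjForm] at h
  exact h.hasUniqueL2Adjoint hG

end Conjugation

section HermitianMatrixForms

variable {n : ℕ} {P A : CSpace n → Matrix (Fin n) (Fin n) ℂ}

theorem assocForm_eq_halfIForm (A : CSpace n → Matrix (Fin n) (Fin n) ℂ) :
    assocForm A = halfIForm A := by
  funext z I J
  have hentry : ∀ (j k : Fin n) (c d : ℂ),
      realTensor (A z) (Pi.single j c) (Complex.I • Pi.single k d)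
        = (A z j k * c * conj (Complex.I * d)).re := fun j k c d => by
    rw [realTensor, Finset.sum_eq_single j (fun l _ hl => by simp [hl]) (by simp),
      Finset.sum_eq_single k (fun l _ hl => by simp [hl]) (by simp)]
    simp
  simp only [assocForm, complexEntry, halfIForm, hentry, map_one, map_neg, Complex.conj_I, mul_one,
    mul_neg, mul_assoc, Complex.I_mul_I, Complex.neg_re, Complex.mul_I_re, neg_neg,
    Complex.ofReal_neg]
  linear_combination Complex.I / 2 * Complex.re_add_im (A z (I 0) (J 0))
    - (A z (I 0) (J 0)).im / 2 * Complex.I_mul_I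

theorem indexTransform_halfIForm :
    indexTransform P (halfIForm A) = halfIForm fun z => P z * A z * P z := by
  funext z I J
  simp only [indexTransform_apply, ← (Equiv.funUnique (Fin 1) (Fin n)).symm.sum_comp,
    kroneckerPow_fin_one, halfIForm, Matrix.mul_apply, Finset.sum_mul, Finset.mul_sum]
  rw [Finset.sum_comm]
  refine Finset.sum_congr rfl fun j _ => Finset.sum_congr rfl fun k _ => ?_
  simp only [Equiv.funUnique_symm_apply, uniqueElim_const]
  ring

theorem conjForm_halfIForm : conjForm (halfIForm A) = -halfIForm fun z => (A z).conjTranspose := by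
  funext z I J
  simp [conjForm, halfIForm, Matrix.conjTranspose_apply, neg_div, Complex.conj_ofNat]

theorem isSmoothForm_halfIForm {U : Set (CSpace n)}
    (hA : ∀ j k, ContDiffOn ℝ ∞ (fun z => A z j k) U) : IsSmoothForm U (halfIForm A) where
  smooth I J := contDiffOn_const.mul (hA (I 0) (J 0))
  alternating_left z _ I J σ := by simp [Subsingleton.elim σ 1]
  alternating_right z _ I J σ := by simp [Subsingleton.elim σ 1]

end HermitianMatrixForms

section Torsion

variable {n : ℕ} {U : Set (CSpace n)} {G A : CSpace n → Matrix (Fin n) (Fin n) ℂ}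
  {z : CSpace n} {D : (CSpace n → ℂ) → CSpace n → ℂ}

/-- The derivative of a `(1,1)`-tensor computed on its raised components, `G ∂(G⁻¹ A G⁻¹) G`. -/
def raisedDeriv (D : (CSpace n → ℂ) → CSpace n → ℂ) (G A : CSpace n → Matrix (Fin n) (Fin n) ℂ)
    (z : CSpace n) : Matrix (Fin n) (Fin n) ℂ :=
  matrixDeriv D A z - matrixDeriv D G z * (G z)⁻¹ * A z - A z * (G z)⁻¹ * matrixDeriv D G z

/-- The torsion components `T_{i j k̄}` with `i` fixed, as a matrix in `j` and `k`. -/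
def torsionMatrix (G : CSpace n → Matrix (Fin n) (Fin n) ℂ) (i : Fin n) (z : CSpace n) :
    Matrix (Fin n) (Fin n) ℂ :=
  Matrix.of (torsion G z i)

/-- The trace `g^{k l̄} T_{i k l̄}` of the torsion. -/
def torsionTrace (G : CSpace n → Matrix (Fin n) (Fin n) ℂ) (i : Fin n) (z : CSpace n) : ℂ :=
  ((G z)⁻¹ * torsionMatrix G i z).trace

theorem chernGamma_eq_mul (G : CSpace n → Matrix (Fin n) (Fin n) ℂ) (i j k : Fin n)
    (z : CSpace n) : chernGamma G i j k z = (matrixDeriv (dz i) G z * (G z)⁻¹) j k := by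
  simp only [chernGamma, gInv, Matrix.mul_apply, matrixDeriv_apply, mul_comm]

namespace IsMetricOn

theorem matrixDeriv_inv (hG : IsMetricOn U G) (hz : z ∈ U) (hD : IsConstantVectorField D) :
    matrixDeriv D (fun y => (G y)⁻¹) z = -((G z)⁻¹ * matrixDeriv D G z * (G z)⁻¹) :=
  HermitianFlow.matrixDeriv_inv hD hG.isOpen hG.smooth (fun _ hy => hG.det_ne_zero hy) hz

theorem contDiffOn_inv_mul_mul_inv (hG : IsMetricOn U G)
    (hA : ∀ j k, ContDiffOn ℝ ∞ (fun y => A y j k) U) (j k : Fin n) :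
    ContDiffOn ℝ ∞ (fun y => ((G y)⁻¹ * A y * (G y)⁻¹) j k) U := by
  simp only [Matrix.mul_apply]
  exact ContDiffOn.sum fun l _ => (ContDiffOn.sum fun m _ =>
    (hG.contDiffOn_inv j m).mul (hA m l)).mul (hG.contDiffOn_inv l k)

theorem matrixDeriv_inv_mul_mul_inv (hG : IsMetricOn U G) (hz : z ∈ U)
    (hD : IsConstantVectorField D) (hA : ∀ j k, ContDiffOn ℝ ∞ (fun y => A y j k) U) :
    matrixDeriv D (fun y => (G y)⁻¹ * A y * (G y)⁻¹) z
      = (G z)⁻¹ * raisedDeriv D G A z * (G z)⁻¹ := by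
  have hinv : ∀ j k, DifferentiableAt ℝ (fun y => (G y)⁻¹ j k) z := fun j k =>
    hG.differentiableAt hz (hG.contDiffOn_inv j k)
  have hdA : ∀ j k, DifferentiableAt ℝ (fun y => A y j k) z := fun j k =>
    hG.differentiableAt hz (hA j k)
  have hmul : ∀ j k, DifferentiableAt ℝ (fun y => ((G y)⁻¹ * A y) j k) z := fun j k => by
    simp only [Matrix.mul_apply]
    exact DifferentiableAt.fun_sum fun l _ => (hinv j l).fun_mul (hdA l k)
  rw [matrixDeriv_mul hD hmul hinv, matrixDeriv_mul hD hinv hdA, hG.matrixDeriv_inv hz hD,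
    raisedDeriv]
  noncomm_ring

theorem matrixDeriv_conjTranspose (hG : IsMetricOn U G) (hz : z ∈ U) (i : Fin n) :
    (matrixDeriv (dz i) G z).conjTranspose = matrixDeriv (dzbar i) G z := by
  ext j k
  rw [Matrix.conjTranspose_apply, Complex.star_def, matrixDeriv_apply, conj_dz]
  exact (isConstantVectorField_dzbar i).congr_of_eqOn hG.isOpen
    (fun y hy => hG.conj_apply hy k j) hz

theorem torsion_eq (hG : IsMetricOn U G) (hz : z ∈ U) (i j k : Fin n) :
    torsion G z i j k = matrixDeriv (dz i) G z j k - matrixDeriv (dz j) G z i k := by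
  have hlower : ∀ i j, ∑ l, chernGamma G i j l z * G z l k = matrixDeriv (dz i) G z j k := by
    intro i j
    simp only [chernGamma_eq_mul]
    rw [← Matrix.mul_apply, mul_assoc, hG.inv_mul hz, mul_one]
  simp only [torsion, torsionUp, sub_mul, Finset.sum_sub_distrib, hlower]

theorem torsionBar_eq (hG : IsMetricOn U G) (hz : z ∈ U) (i j k : Fin n) :
    torsionBar G z i j k = matrixDeriv (dzbar i) G z k j - matrixDeriv (dzbar j) G z k i := by
  rw [torsionBar, hG.torsion_eq hz, map_sub, ← hG.matrixDeriv_conjTranspose hz,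
    ← hG.matrixDeriv_conjTranspose hz]
  rfl

theorem contDiffOn_torsionMatrix (hG : IsMetricOn U G) (i j k : Fin n) :
    ContDiffOn ℝ ∞ (fun y => torsionMatrix G i y j k) U :=
  (((isConstantVectorField_dz i).contDiffOn hG.isOpen (hG.smooth j k)).sub
    ((isConstantVectorField_dz j).contDiffOn hG.isOpen (hG.smooth i k))).congr
    fun _ hy => hG.torsion_eq hy i j k

theorem conj_torsionTrace (hG : IsMetricOn U G) (hz : z ∈ U) (m : Fin n) :
    conj (torsionTrace G m z) = ((G z)⁻¹ * matrixDeriv (dzbar m) G z).trace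
      - ∑ l, ((G z)⁻¹ * matrixDeriv (dzbar l) G z) l m := by
  simp only [torsionTrace, Matrix.trace, Matrix.diag_apply, Matrix.mul_apply, torsionMatrix,
    Matrix.of_apply, hG.torsion_eq hz, map_sum, map_mul, map_sub, hG.conj_inv_apply hz, mul_sub,
    Finset.sum_sub_distrib, ← hG.matrixDeriv_conjTranspose hz, Matrix.conjTranspose_apply]
  rw [Finset.sum_comm]
  congr 1
  exact Finset.sum_comm

theorem sum_deriv_inv_add_trace_mul_inv (hG : IsMetricOn U G) (hz : z ∈ U) (b : Fin n) :
    ∑ m, (matrixDeriv (dzbar m) (fun y => (G y)⁻¹) z m b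
        + ((G z)⁻¹ * matrixDeriv (dzbar m) G z).trace * (G z)⁻¹ m b)
      = ∑ m, conj (torsionTrace G m z) * (G z)⁻¹ m b := by
  simp only [hG.conj_torsionTrace hz, hG.matrixDeriv_inv hz (isConstantVectorField_dzbar _),
    sub_mul, Finset.sum_sub_distrib, Finset.sum_add_distrib, Matrix.neg_apply,
    Finset.sum_neg_distrib, Finset.sum_mul]
  rw [neg_add_eq_sub, Finset.sum_comm (γ := Fin n)]
  simp only [← Matrix.mul_apply]

end IsMetricOn

end Torsion

section KahlerFormAdjoints

variable {n p q : ℕ} {U : Set (CSpace n)} {G : CSpace n → Matrix (Fin n) (Fin n) ℂ}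
  {z : CSpace n}

theorem kahlerForm_eq_halfIForm (G : CSpace n → Matrix (Fin n) (Fin n) ℂ) :
    kahlerForm G = halfIForm G :=
  assocForm_eq_halfIForm G

theorem indexTransform_congr {P : CSpace n → Matrix (Fin n) (Fin n) ℂ} {α β : CForm n p q}
    (h : α z = β z) : indexTransform P α z = indexTransform P β z := by
  rw [indexTransform, indexTransform, h]

theorem sharp_cons_eq_sum {β : CForm n 2 1} {X : Fin n → CSpace n → Matrix (Fin n) (Fin n) ℂ}
    (hβX : ∀ i I J, β z (Fin.cons i I) J = halfIForm (X i) z I J)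
    (a : Fin n) (A B : Fin 1 → Fin n) :
    sharp G β z (Fin.cons a A) B
      = Complex.I / 2 * ∑ i, (G z)⁻¹ a i * ((G z)⁻¹ * X i z * (G z)⁻¹) (A 0) (B 0) := by
  rw [sharp, indexTransform_cons, Finset.mul_sum]
  refine Finset.sum_congr rfl fun i _ => ?_
  rw [indexTransform_congr (funext₂ fun I J => hβX i I J), indexTransform_halfIForm, halfIForm,
    mul_left_comm]

namespace IsMetricOn

theorem eq_of_sharp_eq (hG : IsMetricOn U G) (hz : z ∈ U) {α β : CForm n p q}
    (h : sharp G α z = sharp G β z) : α z = β z := by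
  have hlower : ∀ α : CForm n p q, indexTransform G (sharp G α) z = α z :=
    indexTransform_indexTransform (R := fun y => (G y)⁻¹) (hG.mul_inv hz)
  rw [← hlower α, ← hlower β]
  exact indexTransform_congr h

theorem sharp_delAdjoint_eq_neg_divergence (hG : IsMetricOn U G) (hz : z ∈ U)
    {β : CForm n (p + 1) q} (hβ : IsSmoothForm U β) (A : Fin p → Fin n) (B : Fin q → Fin n) :
    sharp G (delAdjoint G β) z A B
      = -∑ a, (dzbar a (fun y => sharp G β y (Fin.cons a A) B) z
        + ((G z)⁻¹ * matrixDeriv (dzbar a) G z).trace * sharp G β z (Fin.cons a A) B) := by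
  have hdet := hG.det_ne_zero hz
  rw [hG.sharp_delAdjoint hz, Finset.mul_sum, ← Finset.sum_neg_distrib]
  refine Finset.sum_congr rfl fun a _ => ?_
  have hdzbar := isConstantVectorField_dzbar (n := n) a
  rw [hdzbar.mul
      (((hβ.indexTransform hG.contDiffOn_inv).differentiableAt hG.isOpen hz _ B))
      (hG.differentiableAt hz (contDiffOn_det hG.smooth)),
    hdzbar.det (fun j k => hG.differentiableAt hz (hG.smooth j k)) hdet]
  field_simp

theorem sharp_kahlerForm (hG : IsMetricOn U G) (hz : z ∈ U) :
    sharp G (kahlerForm G) z = halfIForm (fun y => (G y)⁻¹) z := by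
  funext A B
  rw [kahlerForm_eq_halfIForm, sharp, indexTransform_halfIForm, halfIForm, halfIForm,
    hG.inv_mul hz, one_mul]

theorem isSmoothForm_kahlerForm (hG : IsMetricOn U G) : IsSmoothForm U (kahlerForm G) := by
  rw [kahlerForm_eq_halfIForm]
  exact isSmoothForm_halfIForm hG.smooth

theorem delAdjoint_kahlerForm (hG : IsMetricOn U G) (hz : z ∈ U) (I : Fin 0 → Fin n)
    (J : Fin 1 → Fin n) :
    delAdjoint G (kahlerForm G) z I J = -(Complex.I / 2) * conj (torsionTrace G (J 0) z) := by
  let η : CForm n 0 1 := fun z _ J => -(Complex.I / 2) * conj (torsionTrace G (J 0) z)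
  suffices hsharp : sharp G (delAdjoint G (kahlerForm G)) z = sharp G η z from
    congrFun₂ (hG.eq_of_sharp_eq hz hsharp) I J
  funext A B
  have hderiv : ∀ a, dzbar a (fun y => sharp G (kahlerForm G) y (Fin.cons a A) B) z
      = Complex.I / 2 * matrixDeriv (dzbar a) (fun y => (G y)⁻¹) z a (B 0) := fun a => by
    rw [matrixDeriv_apply, ← (isConstantVectorField_dzbar a).const_mul _
      (hG.differentiableAt hz (hG.contDiffOn_inv a (B 0)))]
    exact (isConstantVectorField_dzbar a).congr_of_eqOn hG.isOpen
      (fun y hy => congrFun₂ (hG.sharp_kahlerForm hy) _ B) hz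
  have hη : sharp G η z A B
      = -(Complex.I / 2) * ∑ m, conj (torsionTrace G m z) * (G z)⁻¹ m (B 0) := by
    rw [sharp, indexTransform_apply, Fintype.sum_unique,
      ← (Equiv.funUnique (Fin 1) (Fin n)).symm.sum_comp, Finset.mul_sum]
    refine Finset.sum_congr rfl fun m _ => ?_
    rw [kroneckerPow_fin_one, kroneckerPow_apply, Fin.prod_univ_zero]
    simp only [η, Equiv.funUnique_symm_apply, uniqueElim_const]
    ring
  rw [hG.sharp_delAdjoint_eq_neg_divergence hz hG.isSmoothForm_kahlerForm, hη,
    ← hG.sum_deriv_inv_add_trace_mul_inv hz, Finset.mul_sum, ← Finset.sum_neg_distrib]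
  refine Finset.sum_congr rfl fun a _ => ?_
  rw [hderiv, hG.sharp_kahlerForm hz, halfIForm, Fin.cons_zero]
  ring

theorem conjForm_kahlerForm (hG : IsMetricOn U G) :
    Set.EqOn (conjForm (kahlerForm G)) (-kahlerForm G) U := fun z hz => by
  rw [kahlerForm_eq_halfIForm, conjForm_halfIForm]
  funext I J
  simp only [Pi.neg_apply, halfIForm, Matrix.conjTranspose_apply, Complex.star_def,
    hG.conj_apply hz]

theorem isL2Adjoint_delbar_kahlerForm (hG : IsMetricOn U G) :
    IsL2Adjoint U G delbar (kahlerForm G) (conjForm (delAdjoint G (kahlerForm G))) := by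
  have h := ((hG.isL2Adjoint_delAdjoint hG.isSmoothForm_kahlerForm).conjForm hG).const_smul (-1)
  rw [pow_one, smul_smul, neg_one_mul, neg_neg, one_smul] at h
  exact h.congr hG.isOpen fun z hz => by
    rw [Pi.smul_apply, hG.conjForm_kahlerForm hz, Pi.neg_apply, neg_one_smul, neg_neg]

theorem delbarStar_kahlerForm (hG : IsMetricOn U G) (hz : z ∈ U) (I : Fin 1 → Fin n)
    (J : Fin 0 → Fin n) :
    delbarStar U G (kahlerForm G) z I J = Complex.I / 2 * torsionTrace G (I 0) z := by
  rw [delbarStar, hG.isL2Adjoint_delbar_kahlerForm.eqOn_l2Adjoint hG hz, conjForm,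
    hG.delAdjoint_kahlerForm hz]
  simp [Complex.conj_ofNat, neg_div]

theorem del_kahlerForm (hG : IsMetricOn U G) (hz : z ∈ U) (i : Fin n) (I J : Fin 1 → Fin n) :
    del (kahlerForm G) z (Fin.cons i I) J = halfIForm (torsionMatrix G i) z I J := by
  have hcomp : ∀ (i j k : Fin n), dz i (fun y => Complex.I / 2 * G y j k) z
      = Complex.I / 2 * matrixDeriv (dz i) G z j k := fun i j k =>
    (isConstantVectorField_dz i).const_mul _ (hG.differentiableAt hz (hG.smooth j k))
  have hdrop : (1 : Fin 2).succAbove 0 = 0 := rfl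
  rw [kahlerForm_eq_halfIForm, del, Fin.sum_univ_two]
  simp only [halfIForm, Fin.cons_zero, Fin.cons_one, Fin.zero_succAbove, Fin.succ_zero_eq_one,
    hdrop, Fin.val_zero, Fin.val_one, hcomp, torsionMatrix, Matrix.of_apply, hG.torsion_eq hz]
  ring

theorem dzbar_sharp_cons (hG : IsMetricOn U G) (hz : z ∈ U) {β : CForm n 2 1}
    {X : Fin n → CSpace n → Matrix (Fin n) (Fin n) ℂ}
    (hX : ∀ i j k, ContDiffOn ℝ ∞ (fun y => X i y j k) U)
    (hβX : ∀ y ∈ U, ∀ i I J, β y (Fin.cons i I) J = halfIForm (X i) y I J)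
    (m a : Fin n) (A B : Fin 1 → Fin n) :
    dzbar m (fun y => sharp G β y (Fin.cons a A) B) z = Complex.I / 2 *
      ∑ i, (matrixDeriv (dzbar m) (fun y => (G y)⁻¹) z a i *
          ((G z)⁻¹ * X i z * (G z)⁻¹) (A 0) (B 0)
        + (G z)⁻¹ a i * ((G z)⁻¹ * raisedDeriv (dzbar m) G (X i) z * (G z)⁻¹) (A 0) (B 0)) := by
  have hdm := isConstantVectorField_dzbar (n := n) m
  have hinv : ∀ i, DifferentiableAt ℝ (fun y => (G y)⁻¹ a i) z := fun i =>
    hG.differentiableAt hz (hG.contDiffOn_inv a i)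
  have hraised : ∀ i, DifferentiableAt ℝ
      (fun y => ((G y)⁻¹ * X i y * (G y)⁻¹) (A 0) (B 0)) z := fun i =>
    hG.differentiableAt hz (hG.contDiffOn_inv_mul_mul_inv (hX i) _ _)
  rw [hdm.congr_of_eqOn hG.isOpen (fun y hy => sharp_cons_eq_sum (hβX y hy) a A B) hz,
    hdm.const_mul _ (DifferentiableAt.fun_sum fun i _ => (hinv i).fun_mul (hraised i)),
    hdm.sum fun i _ => (hinv i).fun_mul (hraised i)]
  refine congrArg _ (Finset.sum_congr rfl fun i _ => ?_)
  rw [hdm.mul (hinv i) (hraised i), ← hG.matrixDeriv_inv_mul_mul_inv hz hdm (hX i)]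
  rfl

theorem delAdjoint_eq_halfIForm (hG : IsMetricOn U G) (hz : z ∈ U) {β : CForm n 2 1}
    {X : Fin n → CSpace n → Matrix (Fin n) (Fin n) ℂ} (hβ : IsSmoothForm U β)
    (hX : ∀ i j k, ContDiffOn ℝ ∞ (fun y => X i y j k) U)
    (hβX : ∀ y ∈ U, ∀ i I J, β y (Fin.cons i I) J = halfIForm (X i) y I J) :
    delAdjoint G β z = halfIForm (fun y => -∑ i, ∑ m, (G y)⁻¹ m i •
      (raisedDeriv (dzbar m) G (X i) y + conj (torsionTrace G m y) • X i y)) z := by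
  refine hG.eq_of_sharp_eq hz (funext₂ fun A B => ?_)
  have hcontract : ∀ (i : Fin n) (w : ℂ), ∑ m, (matrixDeriv (dzbar m) (fun y => (G y)⁻¹) z m i * w
      + ((G z)⁻¹ * matrixDeriv (dzbar m) G z).trace * ((G z)⁻¹ m i * w))
      = ∑ m, conj (torsionTrace G m z) * ((G z)⁻¹ m i * w) := fun i w => by
    simp only [← mul_assoc, ← add_mul, ← Finset.sum_mul, hG.sum_deriv_inv_add_trace_mul_inv hz]
  have hlhs : sharp G (delAdjoint G β) z A B = -(Complex.I / 2 * ∑ i, ∑ m,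
      ((G z)⁻¹ m i * ((G z)⁻¹ * raisedDeriv (dzbar m) G (X i) z * (G z)⁻¹) (A 0) (B 0)
        + conj (torsionTrace G m z) *
          ((G z)⁻¹ m i * ((G z)⁻¹ * X i z * (G z)⁻¹) (A 0) (B 0)))) := by
    rw [hG.sharp_delAdjoint_eq_neg_divergence hz hβ, neg_inj]
    simp only [hG.dzbar_sharp_cons hz hX hβX, sharp_cons_eq_sum (hβX z hz),
      Finset.sum_add_distrib (f := fun _ => _ * _), ← hcontract, mul_left_comm _ (Complex.I / 2),
      ← mul_add, ← Finset.mul_sum]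
    refine congrArg _ ?_
    simp only [Finset.mul_sum, ← Finset.sum_add_distrib]
    rw [Finset.sum_comm]
    refine Finset.sum_congr rfl fun i _ => Finset.sum_congr rfl fun m _ => ?_
    ring
  have hrhs := congrFun₃ (indexTransform_halfIForm (P := fun y => (G y)⁻¹)
    (A := fun y => -∑ i, ∑ m, (G y)⁻¹ m i •
      (raisedDeriv (dzbar m) G (X i) y + conj (torsionTrace G m y) • X i y))) z A B
  rw [hlhs, sharp, hrhs, halfIForm]
  simp only [Matrix.neg_mul, Matrix.mul_sum, Matrix.sum_mul, Matrix.mul_smul,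
    Matrix.smul_mul, Matrix.add_mul, Matrix.neg_apply, Matrix.sum_apply,
    Matrix.smul_apply, Matrix.add_apply, smul_eq_mul, mul_neg, mul_add, mul_left_comm]

end IsMetricOn

end KahlerFormAdjoints

section Curvature

variable {n : ℕ} {U : Set (CSpace n)} {G : CSpace n → Matrix (Fin n) (Fin n) ℂ} {z : CSpace n}
  {D D' : (CSpace n → ℂ) → CSpace n → ℂ}

/-- The contraction `g^{l m̄} Ω_{j m̄ l k̄}` of the Chern curvature, a Ricci curvature which differs
from `S` by torsion terms. -/
def mixedRicci (G : CSpace n → Matrix (Fin n) (Fin n) ℂ) (z : CSpace n) :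
    Matrix (Fin n) (Fin n) ℂ :=
  Matrix.of fun j k => ∑ l, ∑ m, gInv G z l m * chernCurvature G z j m l k

theorem torsion_antisymm (G : CSpace n → Matrix (Fin n) (Fin n) ℂ) (z : CSpace n)
    (i j k : Fin n) : torsion G z j i k = -torsion G z i j k := by
  simp only [torsion, torsionUp, ← Finset.sum_neg_distrib, ← neg_mul, neg_sub]

theorem torsionTrace_eq_sum (G : CSpace n → Matrix (Fin n) (Fin n) ℂ) (i : Fin n)
    (z : CSpace n) :
    torsionTrace G i z = ∑ k, ∑ l, gInv G z k l * torsion G z i k l := by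
  rw [Finset.sum_comm]
  rfl

namespace IsMetricOn

theorem differentiableAt_matrixDeriv (hG : IsMetricOn U G) (hz : z ∈ U)
    (hD : IsConstantVectorField D) (j k : Fin n) :
    DifferentiableAt ℝ (fun y => matrixDeriv D G y j k) z :=
  hG.differentiableAt hz (hD.contDiffOn hG.isOpen (hG.smooth j k))

theorem matrixDeriv_comm (hG : IsMetricOn U G) (hz : z ∈ U) (hD : IsConstantVectorField D)
    (hD' : IsConstantVectorField D') :
    matrixDeriv D (matrixDeriv D' G) z = matrixDeriv D' (matrixDeriv D G) z := by
  ext j k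
  exact hD.comm hD' ((hG.smooth j k).contDiffAt (hG.isOpen.mem_nhds hz))

theorem contDiffOn_inv_mul_matrixDeriv (hG : IsMetricOn U G) (hD : IsConstantVectorField D)
    (j k : Fin n) : ContDiffOn ℝ ∞ (fun y => ((G y)⁻¹ * matrixDeriv D G y) j k) U := by
  simp only [Matrix.mul_apply]
  exact ContDiffOn.sum fun l _ =>
    (hG.contDiffOn_inv j l).mul (hD.contDiffOn hG.isOpen (hG.smooth l k))

theorem contDiffOn_trace_inv_mul_matrixDeriv (hG : IsMetricOn U G) (hD : IsConstantVectorField D) :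
    ContDiffOn ℝ ∞ (fun y => ((G y)⁻¹ * matrixDeriv D G y).trace) U :=
  ContDiffOn.sum fun l _ => hG.contDiffOn_inv_mul_matrixDeriv hD l l

theorem contDiffOn_conj_torsionTrace (hG : IsMetricOn U G) (k : Fin n) :
    ContDiffOn ℝ ∞ (fun y => conj (torsionTrace G k y)) U :=
  ((hG.contDiffOn_trace_inv_mul_matrixDeriv (isConstantVectorField_dzbar k)).sub
    (ContDiffOn.sum fun l _ =>
      hG.contDiffOn_inv_mul_matrixDeriv (isConstantVectorField_dzbar l) l k)).congr
    fun _ hy => hG.conj_torsionTrace hy k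

theorem chernCurvature_eq (hG : IsMetricOn U G) (hz : z ∈ U) (l m j k : Fin n) :
    chernCurvature G z l m j k
      = (matrixDeriv (dz l) G z * (G z)⁻¹ * matrixDeriv (dzbar m) G z
        - matrixDeriv (dzbar m) (matrixDeriv (dz l) G) z) j k := by
  have hdm := isConstantVectorField_dzbar (n := n) m
  have hlower : chernCurvature G z l m j k
      = (-(matrixDeriv (dzbar m) (fun y => matrixDeriv (dz l) G y * (G y)⁻¹) z * G z)) j k := by
    rw [Matrix.neg_apply, Matrix.mul_apply, chernCurvature]
    simp only [matrixDeriv_apply, ← chernGamma_eq_mul, mul_comm]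
  have hprod : matrixDeriv (dzbar m) (fun y => matrixDeriv (dz l) G y * (G y)⁻¹) z
      = matrixDeriv (dzbar m) (matrixDeriv (dz l) G) z * (G z)⁻¹
        - matrixDeriv (dz l) G z * ((G z)⁻¹ * matrixDeriv (dzbar m) G z * (G z)⁻¹) := by
    rw [matrixDeriv_mul hdm (hG.differentiableAt_matrixDeriv hz (isConstantVectorField_dz l))
      fun a b => hG.differentiableAt hz (hG.contDiffOn_inv a b), hG.matrixDeriv_inv hz hdm,
      mul_neg, ← sub_eq_add_neg]
  rw [hlower, hprod]
  simp only [sub_mul, neg_sub, mul_assoc, hG.inv_mul hz, mul_one]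

theorem neg_raisedDeriv_torsionMatrix (hG : IsMetricOn U G) (hz : z ∈ U) (m i j k : Fin n) :
    (-raisedDeriv (dzbar m) G (torsionMatrix G i) z) j k
      = chernCurvature G z i m j k - chernCurvature G z j m i k
        + (matrixDeriv (dzbar m) G z * (G z)⁻¹ * torsionMatrix G i z) j k := by
  have hderiv : matrixDeriv (dzbar m) (torsionMatrix G i) z j k
      = matrixDeriv (dzbar m) (matrixDeriv (dz i) G) z j k
        - matrixDeriv (dzbar m) (matrixDeriv (dz j) G) z i k := by
    simp only [matrixDeriv_apply (F := matrixDeriv _ G)]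
    rw [← (isConstantVectorField_dzbar m).sub
      (hG.differentiableAt_matrixDeriv hz (isConstantVectorField_dz i) j k)
      (hG.differentiableAt_matrixDeriv hz (isConstantVectorField_dz j) i k)]
    exact (isConstantVectorField_dzbar m).congr_of_eqOn hG.isOpen
      (fun y hy => hG.torsion_eq hy i j k) hz
  have hproduct : ∀ X : Matrix (Fin n) (Fin n) ℂ, (torsionMatrix G i z * X) j k
      = (matrixDeriv (dz i) G z * X) j k - (matrixDeriv (dz j) G z * X) i k := fun X => by
    simp only [Matrix.mul_apply, torsionMatrix, Matrix.of_apply, hG.torsion_eq hz, sub_mul,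
      Finset.sum_sub_distrib]
  rw [hG.chernCurvature_eq hz, hG.chernCurvature_eq hz, raisedDeriv]
  simp only [Matrix.neg_apply, Matrix.sub_apply, mul_assoc, hproduct, hderiv]
  ring

theorem sum_deriv_mul_torsionMatrix (hG : IsMetricOn U G) (hz : z ∈ U) (j k : Fin n) :
    ∑ i, ∑ m, gInv G z i m * (matrixDeriv (dzbar m) G z * (G z)⁻¹ * torsionMatrix G i z) j k
      = (1 / 2) * Q2 G z j k := by
  have hexpand : ∀ i m,
      gInv G z i m * (matrixDeriv (dzbar m) G z * (G z)⁻¹ * torsionMatrix G i z) j k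
        = ∑ a, ∑ b, gInv G z i m * gInv G z a b *
          (matrixDeriv (dzbar m) G z j b * torsion G z i a k) := fun i m => by
    simp only [Matrix.mul_apply, torsionMatrix, Matrix.of_apply, Finset.mul_sum, Finset.sum_mul,
      gInv]
    exact Finset.sum_congr rfl fun a _ => Finset.sum_congr rfl fun b _ => by ring
  have hswap : ∑ i, ∑ m, ∑ a, ∑ b, gInv G z i m * gInv G z a b *
      (matrixDeriv (dzbar b) G z j m * torsion G z i a k)
      = -∑ i, ∑ m, ∑ a, ∑ b, gInv G z i m * gInv G z a b *
        (matrixDeriv (dzbar m) G z j b * torsion G z i a k) := by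
    rw [sum_comm_pairs]
    simp only [← Finset.sum_neg_distrib]
    refine Finset.sum_congr rfl fun i _ => Finset.sum_congr rfl fun m _ =>
      Finset.sum_congr rfl fun a _ => Finset.sum_congr rfl fun b _ => ?_
    rw [torsion_antisymm G z i a k]
    ring
  simp only [hexpand, Q2, hG.torsionBar_eq hz, sub_mul, mul_sub, Finset.sum_sub_distrib, hswap]
  ring

theorem conj_torsionTrace_eq_sum (hG : IsMetricOn U G) (hz : z ∈ U) (i : Fin n) :
    conj (torsionTrace G i z) = ∑ k, ∑ l, gInv G z k l * torsionBar G z i l k := by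
  rw [Finset.sum_comm]
  simp only [torsionTrace_eq_sum, map_sum, map_mul, gInv, hG.conj_inv_apply hz, torsionBar]

theorem two_mul_Q4 (hG : IsMetricOn U G) (hz : z ∈ U) (j k : Fin n) :
    2 * Q4 G z j k
      = ∑ i, ∑ m, gInv G z i m * (torsionTrace G i z * torsionBar G z m k j)
        + ∑ i, ∑ m, gInv G z i m * (conj (torsionTrace G m z) * torsion G z i j k) := by
  rw [Q4, sum_comm_pairs, ← mul_assoc, mul_one_div_cancel two_ne_zero, one_mul]
  simp only [hG.conj_torsionTrace_eq_sum hz]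
  simp only [torsionTrace_eq_sum, Finset.sum_mul, Finset.mul_sum,
    ← Finset.sum_add_distrib, mul_add]
  refine Finset.sum_congr rfl fun i _ => Finset.sum_congr rfl fun m _ =>
    Finset.sum_congr rfl fun a _ => Finset.sum_congr rfl fun b _ => ?_
  ring

theorem dz_trace_sub_conj_torsionTrace (hG : IsMetricOn U G) (hz : z ∈ U) (j k : Fin n) :
    dz j (fun y => ((G y)⁻¹ * matrixDeriv (dzbar k) G y).trace - conj (torsionTrace G k y)) z
      = -mixedRicci G z j k := by
  have hdj := isConstantVectorField_dz (n := n) j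
  have hinv : ∀ a b, DifferentiableAt ℝ (fun y => (G y)⁻¹ a b) z := fun a b =>
    hG.differentiableAt hz (hG.contDiffOn_inv a b)
  have hterm : ∀ l, matrixDeriv (dz j) (fun y => (G y)⁻¹ * matrixDeriv (dzbar l) G y) z l k
      = -∑ a, gInv G z a l * chernCurvature G z j l a k := fun l => by
    have hmatrix : matrixDeriv (dz j) (fun y => (G y)⁻¹ * matrixDeriv (dzbar l) G y) z
        = -((G z)⁻¹ * (matrixDeriv (dz j) G z * (G z)⁻¹ * matrixDeriv (dzbar l) G z
          - matrixDeriv (dzbar l) (matrixDeriv (dz j) G) z)) := by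
      have hdl := isConstantVectorField_dzbar (n := n) l
      rw [matrixDeriv_mul hdj hinv (hG.differentiableAt_matrixDeriv hz hdl),
        hG.matrixDeriv_inv hz hdj, hG.matrixDeriv_comm hz hdj hdl]
      noncomm_ring
    rw [hmatrix, Matrix.neg_apply, Matrix.mul_apply]
    simp only [hG.chernCurvature_eq hz, gInv]
  have htrace : Set.EqOn
      (fun y => ((G y)⁻¹ * matrixDeriv (dzbar k) G y).trace - conj (torsionTrace G k y))
      (fun y => ∑ l, ((G y)⁻¹ * matrixDeriv (dzbar l) G y) l k) U := fun y hy => by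
    simp only [hG.conj_torsionTrace hy, sub_sub_cancel]
  rw [hdj.congr_of_eqOn hG.isOpen htrace hz, hdj.sum fun l _ => hG.differentiableAt hz ?_]
  · simp only [← matrixDeriv_apply (F := fun y => (G y)⁻¹ * _), hterm, Finset.sum_neg_distrib]
    rw [Finset.sum_comm]
    rfl
  · exact hG.contDiffOn_inv_mul_matrixDeriv (isConstantVectorField_dzbar l) l k

end IsMetricOn

end Curvature

section Psi

variable {n : ℕ} {U : Set (CSpace n)} {G : CSpace n → Matrix (Fin n) (Fin n) ℂ} {z : CSpace n}

namespace IsMetricOn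

theorem deriv_logDet (hG : IsMetricOn U G) (hz : z ∈ U) {D : (CSpace n → ℂ) → CSpace n → ℂ}
    (hD : IsConstantVectorField D) (I J : Fin 0 → Fin n) :
    D (fun y => logDet G y I J) z = ((G z)⁻¹ * matrixDeriv D G z).trace := by
  have hlog : Set.EqOn (fun y => logDet G y I J) (fun y => Complex.log (G y).det)
      U := fun y hy => by
    have hre : 0 < (G y).det.re := (Complex.pos_iff.1 (hG.posDef y hy).det_pos).1
    change (Real.log (G y).det.re : ℂ) = Complex.log (G y).det
    rw [Complex.ofReal_log hre.le, Complex.conj_eq_iff_re.1 (hG.conj_det hy)]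
  have hslit : (G z).det ∈ Complex.slitPlane :=
    Or.inl (Complex.pos_iff.1 (hG.posDef z hz).det_pos).1
  rw [hD.congr_of_eqOn hG.isOpen hlog hz, hD.comp_of_hasDerivAt (Complex.hasDerivAt_log hslit)
    (hG.differentiableAt hz (contDiffOn_det hG.smooth)),
    hD.det (fun j k => hG.differentiableAt hz (hG.smooth j k)) (hG.det_ne_zero hz),
    inv_mul_cancel_left₀ (hG.det_ne_zero hz)]

theorem delbar_logDet (hG : IsMetricOn U G) (hz : z ∈ U) (I : Fin 0 → Fin n)
    (J : Fin 1 → Fin n) :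
    delbar (logDet G) z I J = ((G z)⁻¹ * matrixDeriv (dzbar (J 0)) G z).trace := by
  simp [delbar, hG.deriv_logDet hz (isConstantVectorField_dzbar _)]

theorem delbar_kahlerForm (hG : IsMetricOn U G) (hz : z ∈ U) (I : Fin 1 → Fin n)
    (J : Fin 2 → Fin n) :
    delbar (kahlerForm G) z I J = -(Complex.I / 2) * torsionBar G z (J 0) (J 1) (I 0) := by
  have hcomp : ∀ i j k : Fin n, dzbar i (fun y => Complex.I / 2 * G y j k) z
      = Complex.I / 2 * matrixDeriv (dzbar i) G z j k := fun i j k =>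
    (isConstantVectorField_dzbar i).const_mul _ (hG.differentiableAt hz (hG.smooth j k))
  have hdrop : (1 : Fin 2).succAbove 0 = 0 := rfl
  rw [kahlerForm_eq_halfIForm, delbar, Fin.sum_univ_two]
  simp only [halfIForm, Fin.zero_succAbove, Fin.succ_zero_eq_one, hdrop, Fin.val_zero, Fin.val_one,
    hcomp, hG.torsionBar_eq hz]
  ring

theorem delStar_kahlerForm (hG : IsMetricOn U G) (hz : z ∈ U) (I : Fin 0 → Fin n)
    (J : Fin 1 → Fin n) :
    delStar U G (kahlerForm G) z I J = -(Complex.I / 2) * conj (torsionTrace G (J 0) z) := by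
  rw [hG.eqOn_delStar hG.isSmoothForm_kahlerForm hz, hG.delAdjoint_kahlerForm hz]

theorem delStar_del_kahlerForm (hG : IsMetricOn U G) (hz : z ∈ U) (I J : Fin 1 → Fin n) :
    delStar U G (del (kahlerForm G)) z I J = Complex.I / 2 *
      (chernS G z (I 0) (J 0) - mixedRicci G z (I 0) (J 0) + (1 / 2) * Q2 G z (I 0) (J 0)
        - ∑ i, ∑ m, gInv G z i m *
          (conj (torsionTrace G m z) * torsion G z i (I 0) (J 0))) := by
  have hdel := hG.isSmoothForm_kahlerForm.del hG.isOpen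
  rw [hG.eqOn_delStar hdel hz, hG.delAdjoint_eq_halfIForm hz hdel hG.contDiffOn_torsionMatrix
    fun y hy => hG.del_kahlerForm hy, halfIForm]
  have hterm : ∀ i m, -((G z)⁻¹ m i * (raisedDeriv (dzbar m) G (torsionMatrix G i) z (I 0) (J 0)
      + conj (torsionTrace G m z) * torsionMatrix G i z (I 0) (J 0)))
      = gInv G z i m * chernCurvature G z i m (I 0) (J 0)
        - gInv G z i m * chernCurvature G z (I 0) m i (J 0)
        + gInv G z i m *
          (matrixDeriv (dzbar m) G z * (G z)⁻¹ * torsionMatrix G i z) (I 0) (J 0)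
        - gInv G z i m * (conj (torsionTrace G m z) * torsion G z i (I 0) (J 0)) := fun i m => by
    have h := hG.neg_raisedDeriv_torsionMatrix hz m i (I 0) (J 0)
    rw [Matrix.neg_apply, neg_eq_iff_eq_neg] at h
    rw [h, torsionMatrix, Matrix.of_apply, gInv]
    ring
  simp only [Matrix.neg_apply, Matrix.sum_apply, Matrix.smul_apply, Matrix.add_apply, smul_eq_mul,
    ← Finset.sum_neg_distrib, hterm, Finset.sum_add_distrib, Finset.sum_sub_distrib,
    hG.sum_deriv_mul_torsionMatrix hz]
  rfl

theorem del_delStar_kahlerForm_add_del_delbar_logDet (hG : IsMetricOn U G) (hz : z ∈ U)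
    (I J : Fin 1 → Fin n) :
    del (delStar U G (kahlerForm G)) z I J + Complex.I / 2 * del (delbar (logDet G)) z I J
      = -(Complex.I / 2 * mixedRicci G z (I 0) (J 0)) := by
  have hdz := isConstantVectorField_dz (n := n) (I 0)
  have hdel : ∀ α : CForm n 0 1, del α z I J = dz (I 0) (fun y => α y ![] J) z := fun α => by
    simp [del, Subsingleton.elim _ ![]]
  have hτ : DifferentiableAt ℝ (fun y => conj (torsionTrace G (J 0) y)) z :=
    hG.differentiableAt hz (hG.contDiffOn_conj_torsionTrace _)
  have htr : DifferentiableAt ℝ (fun y => ((G y)⁻¹ * matrixDeriv (dzbar (J 0)) G y).trace) z :=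
    hG.differentiableAt hz (hG.contDiffOn_trace_inv_mul_matrixDeriv (isConstantVectorField_dzbar _))
  rw [hdel, hdel, hdz.congr_of_eqOn hG.isOpen (fun y hy => hG.delStar_kahlerForm hy ![] J) hz,
    hdz.congr_of_eqOn hG.isOpen (fun y hy => hG.delbar_logDet hy ![] J) hz,
    hdz.const_mul _ hτ, ← mul_neg, ← hG.dz_trace_sub_conj_torsionTrace hz,
    hdz.sub htr hτ]
  ring

theorem hook_delbarStar_delbar_kahlerForm (hG : IsMetricOn U G) (hz : z ∈ U)
    (I J : Fin 1 → Fin n) :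
    hook G (delbarStar U G (kahlerForm G)) (delbar (kahlerForm G)) z I J
      = (1 / 4) * ∑ i, ∑ m,
        gInv G z i m * (torsionTrace G i z * torsionBar G z m (J 0) (I 0)) := by
  simp only [hook, Finset.mul_sum, hG.delbarStar_kahlerForm hz, hG.delbar_kahlerForm hz]
  refine Finset.sum_congr rfl fun i _ => Finset.sum_congr rfl fun m _ => ?_
  simp only [Matrix.cons_val_zero, Matrix.cons_val_one]
  linear_combination (-1 / 4) * gInv G z i m *
    (torsionTrace G i z * torsionBar G z m (J 0) (I 0)) * Complex.I_sq

theorem eqOn_Psi (hG : IsMetricOn U G) :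
    Set.EqOn (Psi U G)
      (halfIForm fun z => chernS G z + (1 / 2 : ℂ) • Q2 G z - (2 : ℂ) • Q4 G z) U := fun z hz => by
  funext I J
  simp only [Psi, Pi.sub_apply, Pi.smul_apply, smul_eq_mul, halfIForm, Matrix.add_apply,
    Matrix.sub_apply, Matrix.smul_apply, hG.delStar_del_kahlerForm hz, hG.two_mul_Q4 hz,
    hG.hook_delbarStar_delbar_kahlerForm hz]
  linear_combination -hG.del_delStar_kahlerForm_add_del_delbar_logDet hz I J

end IsMetricOn

end Psi

section HermitianMetric

variable {n : ℕ} {M : Type*} [TopologicalSpace M] [ChartedSpace (CSpace n) M]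

theorem chartVec_smul (φ : OpenPartialHomeomorph M (CSpace n)) (z : CSpace n) (c : ℂ)
    (u : CSpace n) : chartVec φ z (c • u) = c • chartVec φ z u :=
  map_smul (mfderiv 𝓘(ℂ, CSpace n) 𝓘(ℂ, CSpace n) φ.symm z) c u

namespace HermitianMetric

variable (g : HermitianMetric n M) (x : M)

theorem val_smul_right (c : ℂ) (u v : TangentSpace 𝓘(ℂ, CSpace n) x) :
    g.val x u (c • v) = c.re * g.val x u v + c.im * g.val x u (Complex.I • v) := by
  conv_lhs => rw [← Complex.re_add_im c, add_smul, mul_smul]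
  rw [g.symm, g.add_left, g.smul_left, g.smul_left, g.symm x v, g.symm x (Complex.I • v)]

theorem val_I_smul_left (u v : TangentSpace 𝓘(ℂ, CSpace n) x) :
    g.val x (Complex.I • u) v = -g.val x u (Complex.I • v) := by
  rw [← g.J_invariant x u, smul_smul, g.val_smul_right]
  simp

/-- The Hermitian inner product on a tangent space with real part `g`. It is conjugate linear in
the first argument, hence `g_{j k̄}` is the inner product of `∂/∂xᵏ` with `∂/∂xʲ`. -/
@[reducible]
def innerProductCore : InnerProductSpace.Core ℂ (TangentSpace 𝓘(ℂ, CSpace n) x) where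
  inner u v := g.val x v u + Complex.I * g.val x v (Complex.I • u)
  conj_inner_symm u v := by
    rw [g.symm x u v, g.symm x u, g.val_I_smul_left]
    simp
  re_inner_nonneg u := by
    rcases eq_or_ne u 0 with rfl | hu
    · have := g.val_smul_right x 0 0 0
      simp_all
    · simpa using (g.pos x u hu).le
  add_left u u' v := by
    simp only [smul_add, g.symm x v, g.add_left]
    push_cast
    ring
  smul_left u v c := by
    rw [smul_smul, g.val_smul_right x c, g.val_smul_right x (Complex.I * c)]
    rw [← Complex.re_add_im (conj c), Complex.conj_re, Complex.conj_im, Complex.I_mul_re,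
      Complex.I_mul_im]
    push_cast
    linear_combination (c.im : ℂ) * g.val x v (Complex.I • u) * Complex.I_mul_I
  definite u h := by
    by_contra hu
    simpa [(g.pos x u hu).ne'] using congrArg Complex.re h

open scoped ComplexOrder in
theorem isMetricOn_comp {φ : OpenPartialHomeomorph M (CSpace n)}
    (hφ : φ ∈ IsManifold.maximalAtlas 𝓘(ℂ, CSpace n) ω M) :
    IsMetricOn φ.target (g.comp φ) where
  isOpen := φ.open_target
  smooth j k := (Complex.ofRealCLM.contDiff.comp_contDiffOn (g.smooth φ hφ _ _)).add
    (contDiffOn_const.mul (Complex.ofRealCLM.contDiff.comp_contDiffOn (g.smooth φ hφ _ _)))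
  posDef z hz := by
    have hmd : φ.MDifferentiable 𝓘(ℂ, CSpace n) 𝓘(ℂ, CSpace n) :=
      ⟨(contMDiffOn_of_mem_maximalAtlas hφ).mdifferentiableOn (by simp),
        (contMDiffOn_symm_of_mem_maximalAtlas hφ).mdifferentiableOn (by simp)⟩
    have hframe : LinearIndependent ℂ fun j => chartVec φ z (Pi.single j 1) :=
      (Pi.linearIndependent_single_one (Fin n) ℂ).map'
        (mfderiv 𝓘(ℂ, CSpace n) 𝓘(ℂ, CSpace n) φ.symm z).toLinearMap
        (hmd.symm.ker_mfderiv_eq_bot hz)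
    have hI : ∀ k, chartVec φ z (Pi.single k Complex.I)
        = Complex.I • chartVec φ z (Pi.single k 1) := fun k => by
      rw [← chartVec_smul, ← Pi.single_smul', smul_eq_mul, mul_one]
    let := (g.innerProductCore (φ.symm z)).toNormedAddCommGroup
    let := InnerProductSpace.ofCore (g.innerProductCore (φ.symm z)).toCore
    have hgram : g.comp φ z = (Matrix.gram ℂ fun j => chartVec φ z (Pi.single j 1)).transpose := by
      ext j k
      simp only [comp, hI]
      rfl
    rw [hgram]
    exact (Matrix.posDef_gram_of_linearIndependent (𝕜 := ℂ) hframe).transpose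

end HermitianMetric

end HermitianMetric

section CurvatureFlow

variable {n : ℕ}

theorem IsMetricOn.eqOn_Xi {U : Set (CSpace n)} {G : CSpace n → Matrix (Fin n) (Fin n) ℂ}
    (hG : IsMetricOn U G) :
    Set.EqOn (Xi G)
      (Psi U G - halfIForm fun z => (1 / 2 : ℂ) • Q2 G z - (2 : ℂ) • Q4 G z) U := by
  intro z hz
  ext I J
  rw [Xi, assocForm_eq_halfIForm]
  simp only [Pi.sub_apply, hG.eqOn_Psi hz, halfIForm, Matrix.add_apply, Matrix.sub_apply]
  ring

theorem IsMetricOn.eqOn_neg_Psi_add {U : Set (CSpace n)}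
    {G : CSpace n → Matrix (Fin n) (Fin n) ℂ} (hG : IsMetricOn U G) :
    Set.EqOn
      (-Psi U G + halfIForm fun z => (1 / 2 : ℂ) • Q1 G z + (1 / 4 : ℂ) • Q2 G z
        - (1 / 2 : ℂ) • Q3 G z - Q4 G z)
      (halfIForm fun z => -chernS G z + Qtot G z) U := by
  intro z hz
  ext I J
  simp only [Pi.add_apply, Pi.neg_apply, hG.eqOn_Psi hz, halfIForm, Qtot, Matrix.add_apply,
    Matrix.sub_apply, Matrix.neg_apply, Matrix.smul_apply, smul_eq_mul]
  ring

theorem hasDerivWithinAt_halfIForm_iff {A : ℝ → CSpace n → Matrix (Fin n) (Fin n) ℂ}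
    {A' : CSpace n → Matrix (Fin n) (Fin n) ℂ} {z : CSpace n} {D : Set ℝ} {t : ℝ} :
    (∀ I J, HasDerivWithinAt (fun s => halfIForm (A s) z I J) (halfIForm A' z I J) D t) ↔
      ∀ j k, HasDerivWithinAt (fun s => A s z j k) (A' z j k) D t := by
  refine ⟨fun h j k => ?_, fun h I J => (h (I 0) (J 0)).const_mul _⟩
  have hI : Complex.I / 2 ≠ 0 := by simp
  simpa only [halfIForm, Matrix.cons_val_zero, inv_mul_cancel_left₀ hI] using
    (h ![j] ![k]).const_mul (Complex.I / 2)⁻¹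

theorem isHCF_iff_hasDerivWithinAt_kahlerForm {M : Type*} [TopologicalSpace M]
    [ChartedSpace (CSpace n) M] {D : Set ℝ} {g : ℝ → HermitianMetric n M} :
    IsHCF D g ↔ ∀ t ∈ D, ∀ φ ∈ IsManifold.maximalAtlas 𝓘(ℂ, CSpace n) ω M, ∀ z ∈ φ.target,
      ∀ I J, HasDerivWithinAt (fun s => kahlerForm ((g s).comp φ) z I J)
        (halfIForm (fun y => -chernS ((g t).comp φ) y + Qtot ((g t).comp φ) y) z I J) D t := by
  simp only [kahlerForm_eq_halfIForm, hasDerivWithinAt_halfIForm_iff]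
  rfl

end CurvatureFlow

end HermitianFlow

end

theorem mainTheorem8 {n : ℕ} {M : Type*} [TopologicalSpace M]
    [ChartedSpace (HermitianFlow.CSpace n) M]
    [IsManifold 𝓘(ℂ, HermitianFlow.CSpace n) ω M] :
    (∀ g : HermitianFlow.HermitianMetric n M,
      ∀ φ ∈ IsManifold.maximalAtlas 𝓘(ℂ, HermitianFlow.CSpace n) ω M,
        HermitianFlow.HasUniqueL2Adjoint φ.target (g.comp φ) HermitianFlow.del
          (HermitianFlow.kahlerForm (g.comp φ)) ∧
        HermitianFlow.HasUniqueL2Adjoint φ.target (g.comp φ) HermitianFlow.delbar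
          (HermitianFlow.kahlerForm (g.comp φ)) ∧
        HermitianFlow.HasUniqueL2Adjoint φ.target (g.comp φ) HermitianFlow.del
          (HermitianFlow.del (HermitianFlow.kahlerForm (g.comp φ))) ∧
        Set.EqOn (HermitianFlow.Xi (g.comp φ))
          (HermitianFlow.Psi φ.target (g.comp φ)
            - HermitianFlow.halfIForm (fun z =>
                (1 / 2 : ℂ) • HermitianFlow.Q2 (g.comp φ) z
                  - (2 : ℂ) • HermitianFlow.Q4 (g.comp φ) z))
          φ.target) ∧
    (∀ (D : Set ℝ) (g : ℝ → HermitianFlow.HermitianMetric n M),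
      HermitianFlow.IsHCF D g ↔
        ∀ t ∈ D, ∀ φ ∈ IsManifold.maximalAtlas 𝓘(ℂ, HermitianFlow.CSpace n) ω M,
          ∀ z ∈ φ.target, ∀ (I J : Fin 1 → Fin n),
            HasDerivWithinAt (fun s => HermitianFlow.kahlerForm ((g s).comp φ) z I J)
              ((-HermitianFlow.Psi φ.target ((g t).comp φ)
                + HermitianFlow.halfIForm (fun y =>
                    (1 / 2 : ℂ) • HermitianFlow.Q1 ((g t).comp φ) y
                      + (1 / 4 : ℂ) • HermitianFlow.Q2 ((g t).comp φ) y
                      - (1 / 2 : ℂ) • HermitianFlow.Q3 ((g t).comp φ) y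
                      - HermitianFlow.Q4 ((g t).comp φ) y)) z I J) D t) := by
  refine ⟨fun g φ hφ => ?_, fun D g => ?_⟩
  · have hG := g.isMetricOn_comp hφ
    have hω := hG.isSmoothForm_kahlerForm
    exact ⟨hG.hasUniqueL2Adjoint_del hω, hG.hasUniqueL2Adjoint_delbar hω,
      hG.hasUniqueL2Adjoint_del (hω.del hG.isOpen), hG.eqOn_Xi⟩
  · rw [HermitianFlow.isHCF_iff_hasDerivWithinAt_kahlerForm]
    refine forall₂_congr fun t _ => forall₂_congr fun φ hφ => forall₂_congr fun z hz => ?_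
    rw [((g t).isMetricOn_comp hφ).eqOn_neg_Psi_add hz]
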